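/- Let $\Lambda\subset\mathbb C$ be a lattice with Weierstrass function $\wp$, let $n\ge 1$ be an integer and put $N=n(n+1)/2$. Let $\varepsilon>0$ and let $x_1,\dots,x_N:[0,\varepsilon)\to\mathbb C$ be continuous functions with $x_j(0)=0$ for all $j$ and $x_j(t)\ne x_p(t)$ for all $j\neq p$ and $0<t<\varepsilon$. Suppose that $$U(x,t)=\sum_{j=1}^{N}2\wp(x-x_j(t))$$ solves the KdV equation $U_t=6UU_x-U_{xxx}$ for all $0<t<\varepsilon$ and all $x\in\mathbb C$ that are not poles of $U(\cdot,t)$, so that $U$ is a KdV solution with initial value $U(x,0)=n(n+1)\wp(x)$. Then there are complex numbers $a_1,\dots,a_N$ with $$x_j(t)=a_jt^{1/3}+o(t^{1/3})\qquad (t\to+0,\ j=1,\dots,N),$$ where $t^{1/3}>0$ is the real cube root, such that the following holds. Let $\mu_3=\{\eta\in\mathbb C:\eta^3=1\}$ act on $\mathbb C$ by multiplication. 1. The $a_j$ are pairwise distinct. 2. The set $\{a_1,\dots,a_N\}$ is invariant under $\mu_3$, and the family $(a_j)$ contains each orbit that occurs in it exactly once: for each $j$, the map $k\mapsto a_k$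 is a bijection from $\{k: a_k\in\mu_3a_j\}$ onto $\mu_3a_j$. 3. If $3\mid N$, then $\mu_3$ acts freely on $\{a_1,\dots,a_N\}$. 4. If $3\nmid N$ (that is, $N\equiv 1 \pmod 3$), then $a_j=0$ for exactly one $j$. 5. In all cases, every orbit other than $\{0\}$ is free, and $a_j^3\neq a_k^3$ whenever $a_j$ and $a_k$ lie in different orbits. -/

import Mathlib

open Filter Topology
open scoped Pointwise

/-- `u` satisfies the KdV equation `u_t = 6 u u_x - u_xxx` at the point `(z, t)`, where the space
variable `z` is complex and the time `t` is real. -/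
def KdVAt (u : ℂ → ℝ → ℂ) (z : ℂ) (t : ℝ) : Prop :=
  HasDerivAt (fun s : ℝ => u z s)
    (6 * u z t * deriv (fun y : ℂ => u y t) z - iteratedDeriv 3 (fun y : ℂ => u y t) z) t

/-- On the time interval `[0, ε)`, the function `u` is a KdV solution with initial value
`n (n + 1) ℘(z)`, where `℘` is the Weierstrass function of the lattice spanned by `L`, and it has
the form `u(z, t) = ∑ j, 2 ℘(z - x j t)` with `n (n + 1) / 2` continuously moving poles, which all
start at `x j 0 = 0` and are pairwise different for `t > 0`. (The division is exact.) -/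
structure IsLameKdVSolution (L : PeriodPair) (n : ℕ) (ε : ℝ) (u : ℂ → ℝ → ℂ)
    (x : Fin (n * (n + 1) / 2) → ℝ → ℂ) : Prop where
  initial : ∀ z : ℂ, z ∉ L.lattice → u z 0 = n * (n + 1) * L.weierstrassP z
  form : ∀ t ∈ Set.Ico 0 ε, ∀ z : ℂ, (∀ j, z - x j t ∉ L.lattice) →
    u z t = ∑ j, 2 * L.weierstrassP (z - x j t)
  kdv : ∀ t ∈ Set.Ioo 0 ε, ∀ z : ℂ, (∀ j, z - x j t ∉ L.lattice) → KdVAt u z t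
  pole_zero : ∀ j, x j 0 = 0
  pole_continuousOn : ∀ j, ContinuousOn (x j) (Set.Ico 0 ε)
  pole_ne : ∀ t ∈ Set.Ioo 0 ε, ∀ j k, j ≠ k → x j t ≠ x k t

/-! Comparing Laurent coefficients of the KdV equation at a moving pole gives the elliptic
Calogero-Moser flow `x_i' = -12 ∑ ℘(x_i - x_k)` and the locus equations `∑ ℘'(x_i - x_k) = 0`
(`PeriodPair.pole_dynamics`). These are singular at the collision `t = 0`, but the power sums of the
poles are not: symmetrizing over pairs and adding multiples of the locus equations cancels the
singularities. The derivative of the `m`-th power sum becomes a polynomial of degree `m - 3` in the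
poles, plus a remainder of order `m` from the regular part of `℘` (`hasDerivAt_sum_pow`).

This homogeneity forces the scale `t^(1/3)`. A unit vector cannot have all its power sums small, so
the poles are `O(t^(1/3))` (`exists_norm_le_cubeRoot`). By induction on `m`, L'Hôpital's rule gives
limits of the rescaled power sums, zero unless `3 ∣ m`. Together with continuity, these make the
individual rescaled poles converge to some `a_j`.

The limits inherit a rational locus relation. Testing it against a polynomial with a triple zero at
a supposedly repeated point shows that the `a_j` are distinct (`injective_of_sum_pow`). As only
power sums of index divisible by three survive, the set of the `a_j` is invariant under the cube
roots of unity; the orbit statements and the count modulo three follow. -/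

/-! ### The polynomial pair interaction -/

/-- The polynomial `∑ (i + 1) (l + 1) a ^ i b ^ l`, summed over `i + l = m - 3`. -/
noncomputable def pairKernel (m : ℕ) (a b : ℂ) : ℂ :=
  ∑ i ∈ Finset.range (m - 2), ((i + 1 : ℕ) : ℂ) * ((m - 2 - i : ℕ) : ℂ) * a ^ i * b ^ (m - 3 - i)

theorem sum_range_succ_mul_pow_mul_pow (M : ℕ) (a b : ℂ) :
    (∑ i ∈ Finset.range (M + 2), ((i + 1 : ℕ) : ℂ) * a ^ i * b ^ (M + 1 - i)) =
      b * (∑ i ∈ Finset.range (M + 1), ((i + 1 : ℕ) : ℂ) * a ^ i * b ^ (M - i)) +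
        (M + 2) * a ^ (M + 1) := by
  rw [Finset.sum_range_succ, Finset.mul_sum]
  congr 1
  · refine Finset.sum_congr rfl fun i hi => ?_
    rw [show M + 1 - i = (M - i) + 1 by grind]
    ring
  · rw [Nat.sub_self]
    push_cast
    ring

theorem pairKernel_add_four (M : ℕ) (a b : ℂ) :
    pairKernel (M + 4) a b = b * pairKernel (M + 3) a b +
      ∑ i ∈ Finset.range (M + 2), ((i + 1 : ℕ) : ℂ) * a ^ i * b ^ (M + 1 - i) := by
  simp only [pairKernel, show M + 4 - 2 = M + 2 by lia, show M + 3 - 2 = M + 1 by lia,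
    show M + 4 - 3 = M + 1 by lia, show M + 3 - 3 = M by lia]
  rw [Finset.sum_range_succ, Finset.sum_range_succ _ (M + 1), Finset.mul_sum, ← add_assoc,
    ← Finset.sum_add_distrib]
  congr 1
  · refine Finset.sum_congr rfl fun i hi => ?_
    have : i < M + 1 := Finset.mem_range.1 hi
    rw [show M + 1 - i = (M - i) + 1 by lia, show M + 2 - i = (M - i) + 2 by lia]
    push_cast
    ring
  · simp

theorem sq_sub_mul_sum_range_succ (M : ℕ) (a b : ℂ) :
    (a - b) ^ 2 * (∑ i ∈ Finset.range (M + 1), ((i + 1 : ℕ) : ℂ) * a ^ i * b ^ (M - i)) =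
      (M + 1) * a ^ (M + 2) - (M + 2) * a ^ (M + 1) * b + b ^ (M + 2) := by
  induction M with
  | zero => simp; ring
  | succ M ih =>
    rw [sum_range_succ_mul_pow_mul_pow, mul_add, mul_left_comm, ih]
    push_cast
    ring

/-- Divided by `(a - b) ^ 3`, the right side is the interaction in which `1 / z ^ 2` and `-2 / z ^
3` replace `℘` and `℘'`. It vanishes to third order at `a = b`, so the quotient is a polynomial. -/
theorem cube_sub_mul_pairKernel (m : ℕ) (a b : ℂ) :
    (a - b) ^ 3 * pairKernel m a b =
      m * (a ^ (m - 1) + b ^ (m - 1)) * (a - b) - 2 * (a ^ m - b ^ m) := by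
  match m with
  | 0 => simp [pairKernel]
  | 1 => simp [pairKernel]; ring
  | 2 => simp [pairKernel]; ring
  | M + 3 =>
    rw [show M + 3 - 1 = M + 2 by lia]
    induction M with
    | zero => simp [pairKernel]; ring
    | succ M ih =>
      have h := sq_sub_mul_sum_range_succ (M + 1) a b
      rw [show M + 1 + 3 = M + 4 by lia, pairKernel_add_four]
      push_cast at ih h ⊢
      linear_combination b * ih + (a - b) * h

theorem six_mul_pairKernel_self (m : ℕ) (a : ℂ) :
    6 * pairKernel m a a = m * (m - 1) * (m - 2) * a ^ (m - 3) := by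
  have key : ∀ M : ℕ, 2 * (∑ i ∈ Finset.range (M + 1), ((i + 1 : ℕ) : ℂ) * a ^ i * a ^ (M - i)) =
      (M + 1) * (M + 2) * a ^ M := by
    intro M
    induction M with
    | zero => simp
    | succ M ih =>
      rw [sum_range_succ_mul_pow_mul_pow, mul_add, mul_left_comm, ih]
      push_cast
      ring
  match m with
  | 0 => simp [pairKernel]
  | 1 => simp [pairKernel]
  | 2 => simp [pairKernel]
  | M + 3 =>
    rw [show M + 3 - 3 = M by lia]
    induction M with
    | zero => simp [pairKernel]; ring
    | succ M ih =>
      rw [show M + 1 + 3 = M + 4 by lia, pairKernel_add_four, mul_add, mul_left_comm, ih]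
      linear_combination (norm := (push_cast; ring)) 3 * key (M + 1)

/-- Homogeneity of degree `m - 3`; the factor `c ^ 3` keeps the exponent nonnegative when `m < 3`.
-/
theorem pairKernel_mul_mul (m : ℕ) (c a b : ℂ) :
    c ^ 3 * pairKernel m (c * a) (c * b) = c ^ m * pairKernel m a b := by
  rcases lt_or_ge m 3 with hm | hm
  · simp [pairKernel, show m - 2 = 0 by lia]
  · simp only [pairKernel, Finset.mul_sum]
    refine Finset.sum_congr rfl fun i hi => ?_
    have : i < m - 2 := Finset.mem_range.1 hi
    rw [show c ^ m = c ^ 3 * c ^ i * c ^ (m - 3 - i) by rw [← pow_add, ← pow_add]; congr 1; lia]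
    ring

theorem continuous_pairKernel (m : ℕ) :
    Continuous fun p : ℂ × ℂ => pairKernel m p.1 p.2 := by
  unfold pairKernel
  fun_prop

theorem exists_norm_pairKernel_le (m : ℕ) :
    ∃ C : ℝ, 0 ≤ C ∧ ∀ (a b : ℂ) (S : ℝ), ‖a‖ ≤ S → ‖b‖ ≤ S → S ^ 3 * ‖pairKernel m a b‖ ≤ C * S ^ m := by
  have hK : IsCompact (Metric.closedBall (0 : ℂ) 1 ×ˢ Metric.closedBall (0 : ℂ) 1) :=
    (isCompact_closedBall _ _).prod (isCompact_closedBall _ _)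
  obtain ⟨C, hC⟩ := hK.exists_bound_of_continuousOn (continuous_pairKernel m).continuousOn
  refine ⟨max C 0, le_max_right _ _, fun a b S ha hb => ?_⟩
  rcases (le_trans (norm_nonneg a) ha).eq_or_lt with h0 | hS
  · rw [← h0]; simp; positivity
  · have h1 := pairKernel_mul_mul m (S : ℂ) (a / S) (b / S)
    have hS' : (S : ℂ) ≠ 0 := by exact_mod_cast hS.ne'
    rw [mul_div_cancel₀ _ hS', mul_div_cancel₀ _ hS'] at h1
    have h2 := congrArg norm h1
    simp only [norm_mul, norm_pow, Complex.norm_real, Real.norm_of_nonneg hS.le] at h2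
    rw [h2, mul_comm]
    gcongr
    refine (hC (a / S, b / S) ?_).trans (le_max_left _ _)
    simp only [Set.mem_prod, mem_closedBall_zero_iff, norm_div, Complex.norm_real,
      Real.norm_of_nonneg hS.le]
    exact ⟨(div_le_one hS).2 ha, (div_le_one hS).2 hb⟩

theorem sum_sum_ne_eq {N : ℕ} (g : Fin N → Fin N → ℂ) :
    ∑ j, ∑ k ∈ Finset.univ.erase j, g j k = ∑ j, ∑ k, g j k - ∑ j, g j j := by
  rw [← Finset.sum_sub_distrib]
  refine Finset.sum_congr rfl fun j _ => ?_
  rw [← Finset.add_sum_erase _ _ (Finset.mem_univ j)]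
  ring

/-- Adding the diagonal turns the interaction into a polynomial in power sums of index at most `m -
3`. This closes the induction on `m` in `exists_tendsto_sum_pow`. -/
theorem sum_sum_pairKernel {N : ℕ} (m : ℕ) (a : Fin N → ℂ) :
    ∑ j, ∑ k ∈ Finset.univ.erase j, pairKernel m (a j) (a k) =
      ∑ i ∈ Finset.range (m - 2), ((i + 1 : ℕ) : ℂ) * ((m - 2 - i : ℕ) : ℂ) *
        ((∑ j, a j ^ i) * ∑ j, a j ^ (m - 3 - i)) -
      (m * (m - 1) * (m - 2) / 6) * ∑ j, a j ^ (m - 3) := by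
  rw [sum_sum_ne_eq]
  congr 1
  · simp only [pairKernel, Finset.sum_mul_sum]
    simp_rw [Finset.mul_sum]
    rw [Finset.sum_comm]
    refine Eq.trans (Finset.sum_congr rfl fun k _ => Finset.sum_comm) ?_
    rw [Finset.sum_comm]
    refine Finset.sum_congr rfl fun i _ => ?_
    rw [Finset.sum_comm]
    refine Finset.sum_congr rfl fun i _ => Finset.sum_congr rfl fun k _ => ?_
    ring
  · rw [Finset.mul_sum]
    refine Finset.sum_congr rfl fun j _ => ?_
    linear_combination six_mul_pairKernel_self m (a j) / 6

/-! ### Power sums determine a finite set of points -/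

/-- Equal power sums imply equal ranges. -/
theorem range_subset_of_sum_pow_eq {N : ℕ} {a b : Fin N → ℂ}
    (h : ∀ m : ℕ, ∑ j, a j ^ m = ∑ j, b j ^ m) : Set.range a ⊆ Set.range b := by
  classical
  have hp : ∀ p : Polynomial ℂ, ∑ j, p.eval (a j) = ∑ j, p.eval (b j) := by
    intro p
    simp only [Polynomial.eval_eq_sum_range]
    rw [Finset.sum_comm, Finset.sum_comm (s := Finset.univ)]
    simp only [← Finset.mul_sum, h]
  rintro _ ⟨i, rfl⟩
  by_contra hi
  set s : Finset ℂ := (Finset.univ.image a ∪ Finset.univ.image b).erase (a i) with hs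
  -- This polynomial vanishes at every point of both families except `a i`. One side is therefore
  -- the multiplicity of `a i` times a nonzero value, the other side zero.
  have h1 := hp (∏ c ∈ s, (Polynomial.X - Polynomial.C c))
  simp only [Polynomial.eval_prod, Polynomial.eval_sub, Polynomial.eval_X, Polynomial.eval_C] at h1
  have hb : ∀ j, ∏ c ∈ s, (b j - c) = 0 := fun j => by
    refine Finset.prod_eq_zero (i := b j) ?_ (sub_self _)
    simp only [hs, Finset.mem_erase, Finset.mem_union, Finset.mem_image, Finset.mem_univ, true_and]
    exact ⟨fun e => hi ⟨j, e⟩, Or.inr ⟨j, rfl⟩⟩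
  have ha : ∀ j, ∏ c ∈ s, (a j - c) = if a j = a i then ∏ c ∈ s, (a i - c) else 0 := fun j => by
    split_ifs with e
    · rw [e]
    · refine Finset.prod_eq_zero (i := a j) ?_ (sub_self _)
      simp only [hs, Finset.mem_erase, Finset.mem_union, Finset.mem_image, Finset.mem_univ,
        true_and]
      exact ⟨e, Or.inl ⟨j, rfl⟩⟩
  rw [Finset.sum_congr rfl fun j _ => ha j, Finset.sum_congr rfl fun j _ => hb j] at h1
  simp only [Finset.sum_const_zero, ← Finset.sum_filter, Finset.sum_const, nsmul_eq_mul,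
    mul_eq_zero, Nat.cast_eq_zero, Finset.card_eq_zero] at h1
  rcases h1 with h1 | h1
  · have : i ∈ Finset.univ.filter fun j => a j = a i := by simp
    rw [h1] at this
    simp at this
  · rw [Finset.prod_eq_zero_iff] at h1
    obtain ⟨c, hc, hc'⟩ := h1
    rw [hs, Finset.mem_erase] at hc
    exact hc.1 (sub_eq_zero.1 hc').symm

theorem range_eq_of_sum_pow_eq {N : ℕ} {a b : Fin N → ℂ}
    (h : ∀ m : ℕ, ∑ j, a j ^ m = ∑ j, b j ^ m) : Set.range a = Set.range b :=
  (range_subset_of_sum_pow_eq h).antisymm (range_subset_of_sum_pow_eq fun m => (h m).symm)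

/-- Some power sum of a unit vector is bounded below. The exponents are bounded. -/
theorem exists_le_norm_sum_pow (N : ℕ) : ∃ c : ℝ, 0 < c ∧ ∃ M : ℕ, ∀ y : Fin N → ℂ, ‖y‖ = 1 →
    ∃ m ∈ Finset.Icc 1 M, c ≤ ‖∑ j, y j ^ m‖ := by
  by_contra! H
  have hK : IsCompact (Metric.sphere (0 : Fin N → ℂ) 1) := isCompact_sphere _ _
  have hseq : ∀ M : ℕ, ∃ y ∈ Metric.sphere (0 : Fin N → ℂ) 1, ∀ m ∈ Finset.Icc 1 M,
      ‖∑ j, y j ^ m‖ < 1 / ((M : ℝ) + 1) := by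
    intro M
    obtain ⟨y, hy, h⟩ := H (1 / ((M : ℝ) + 1)) (by positivity) M
    exact ⟨y, by simpa using hy, h⟩
  choose y hy h using hseq
  obtain ⟨z, hz, φ, hφ, hlim⟩ := hK.tendsto_subseq hy
  -- A limit of counterexamples has the power sums of the zero vector, hence is zero, although it
  -- lies on the unit sphere.
  have hz0 : ∀ m : ℕ, ∑ j, z j ^ m = ∑ j, (0 : Fin N → ℂ) j ^ m := by
    intro m
    rcases Nat.eq_zero_or_pos m with rfl | hm
    · simp
    have h1 : Tendsto (fun k => ∑ j, (y (φ k)) j ^ m) atTop (𝓝 (∑ j, z j ^ m)) :=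
      tendsto_finsetSum _ fun j _ => ((tendsto_pi_nhds.1 hlim) j).pow m
    have h2 : Tendsto (fun k => ∑ j, (y (φ k)) j ^ m) atTop (𝓝 0) := by
      rw [tendsto_zero_iff_norm_tendsto_zero]
      refine squeeze_zero' (.of_forall fun _ => norm_nonneg _) ?_
        ((tendsto_one_div_add_atTop_nhds_zero_nat (𝕜 := ℝ)).comp hφ.tendsto_atTop)
      filter_upwards [eventually_ge_atTop m] with k hk
      exact (h (φ k) m (Finset.mem_Icc.2 ⟨hm, hk.trans (hφ.id_le k)⟩)).le
    rw [tendsto_nhds_unique h1 h2]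
    simp [hm.ne']
  have hz1 : z = 0 := by
    ext j
    obtain ⟨k, hk⟩ := range_subset_of_sum_pow_eq hz0 ⟨j, rfl⟩
    simpa using hk.symm
  simp [hz1] at hz

/-! ### The KdV equation at a double pole -/

theorem eventuallyEq_deriv_div_pow_add {f G : ℂ → ℂ} {c X z : ℂ} {n : ℕ} (hz : z ≠ X)
    (hG : AnalyticAt ℂ G z) (hf : f =ᶠ[𝓝 z] fun y => c / (y - X) ^ n + G y) :
    deriv f =ᶠ[𝓝 z] fun y => (-n * c) / (y - X) ^ (n + 1) + deriv G y := by
  refine hf.deriv.trans ?_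
  filter_upwards [hG.eventually_analyticAt, isOpen_ne.mem_nhds hz] with y hy hyX
  have hyX' : y - X ≠ 0 := sub_ne_zero.2 hyX
  have h1 : HasDerivAt (fun y => c / (y - X) ^ n) ((-n * c) / (y - X) ^ (n + 1)) y := by
    have h2 := (((hasDerivAt_id y).sub_const X).pow n).inv (pow_ne_zero n hyX')
    have h3 := h2.const_mul c
    refine (h3.congr_deriv ?_).congr_of_eventuallyEq (.of_forall fun w => ?_)
    · rcases n with _ | n
      · simp
      · simp only [id, Pi.pow_apply, Nat.add_sub_cancel]
        field_simp
        ring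
    · simp [div_eq_mul_inv]
  exact (h1.add hy.differentiableAt.hasDerivAt).deriv

/-- Local analysis of the KdV equation at a moving double pole `2 / (z - X) ^ 2`. -/
theorem kdv_local {f G k : ℂ → ℂ} {X c : ℂ} (hG : AnalyticAt ℂ G X) (hk : ContinuousAt k X)
    (hf : ∀ᶠ z in 𝓝[≠] X, f z = 2 / (z - X) ^ 2 + G z)
    (h : ∀ᶠ z in 𝓝[≠] X, 4 * c / (z - X) ^ 3 + k z = 6 * f z * deriv f z - iteratedDeriv 3 f z) :
    c = -6 * G X ∧ deriv G X = 0 := by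
  set q : ℂ → ℂ := fun z => 6 * G z * deriv G z - deriv (deriv (deriv G)) z - k z with hq
  have hqc : ContinuousAt q X :=
    ((hG.continuousAt.const_mul 6).mul hG.deriv.continuousAt).sub
      hG.deriv.deriv.deriv.continuousAt |>.sub hk
  have hw : Tendsto (fun z => z - X) (𝓝[≠] X) (𝓝 0) := by
    have : Tendsto (fun z => z - X) (𝓝 X) (𝓝 (X - X)) := (continuous_sub_right X).tendsto X
    rw [sub_self] at this
    exact this.mono_left nhdsWithin_le_nhds
  -- The fifth-order poles of `6 f f'` and `f'''` cancel because the coefficient of the double pole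
  -- is `2`. After multiplication by `(z - X) ^ 3`, the orders zero and one give the two
  -- conclusions.
  have key : ∀ᶠ z in 𝓝[≠] X,
      4 * c + 24 * G z - 12 * (z - X) * deriv G z = (z - X) ^ 3 * q z := by
    have hf' := eventually_eventually_nhdsWithin.2 hf
    filter_upwards [h, hf', self_mem_nhdsWithin,
      nhdsWithin_le_nhds hG.eventually_analyticAt] with z hz hfz hzX hGz
    have hzX' : z ≠ X := hzX
    have e0 : f =ᶠ[𝓝 z] fun y => 2 / (y - X) ^ 2 + G y := by
      rwa [isOpen_compl_singleton.nhdsWithin_eq hzX] at hfz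
    have e1 := eventuallyEq_deriv_div_pow_add hzX' hGz e0
    have e2 := eventuallyEq_deriv_div_pow_add hzX' hGz.deriv e1
    have e3 := eventuallyEq_deriv_div_pow_add hzX' hGz.deriv.deriv e2
    rw [iteratedDeriv_succ, iteratedDeriv_succ, iteratedDeriv_one, e0.self_of_nhds,
      e1.self_of_nhds, e3.self_of_nhds] at hz
    have hw0 : z - X ≠ 0 := sub_ne_zero.2 hzX'
    simp only [hq]
    field_simp at hz
    push_cast at hz
    apply mul_left_cancel₀ (pow_ne_zero 8 hw0)
    generalize z - X = w at hz ⊢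
    linear_combination hz
  have hG0 := hG.continuousAt.tendsto.mono_left (nhdsWithin_le_nhds (s := {X}ᶜ))
  have hG1 := hG.deriv.continuousAt.tendsto.mono_left (nhdsWithin_le_nhds (s := {X}ᶜ))
  have hq0 := hqc.tendsto.mono_left (nhdsWithin_le_nhds (s := {X}ᶜ))
  have hc : 4 * c + 24 * G X - 12 * 0 * deriv G X = 0 ^ 3 * q X :=
    tendsto_nhds_unique ((((hG0.const_mul 24).const_add (4 * c)).sub
      ((hw.const_mul 12).mul hG1)).congr' key) ((hw.pow 3).mul hq0)
  have hc' : c = -6 * G X := by linear_combination hc / 4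
  refine ⟨hc', ?_⟩
  have hs : Tendsto (slope G X) (𝓝[≠] X) (𝓝 (deriv G X)) :=
    hasDerivAt_iff_tendsto_slope.1 hG.differentiableAt.hasDerivAt
  have key2 : ∀ᶠ z in 𝓝[≠] X, 24 * slope G X z - 12 * deriv G z = (z - X) ^ 2 * q z := by
    filter_upwards [key, self_mem_nhdsWithin] with z hz hzX
    have hw0 : z - X ≠ 0 := sub_ne_zero.2 hzX
    rw [slope_def_field]
    field_simp
    linear_combination hz - 4 * hc'
  have hd : 24 * deriv G X - 12 * deriv G X = 0 ^ 2 * q X :=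
    tendsto_nhds_unique (((hs.const_mul 24).sub (hG1.const_mul 12)).congr' key2)
      ((hw.pow 2).mul hq0)
  linear_combination hd / 12

/-! ### Local behaviour of the Weierstrass function -/

namespace PeriodPair

variable (L : PeriodPair)

theorem hasDerivAt_weierstrassP {z : ℂ} (hz : z ∉ L.lattice) :
    HasDerivAt L.weierstrassP (L.derivWeierstrassP z) z := by
  rw [← L.deriv_weierstrassP]
  exact (L.differentiableOn_weierstrassP.differentiableAt
    (L.isClosed_lattice.isOpen_compl.mem_nhds hz)).hasDerivAt

theorem weierstrassP_eq_inv_sq_add (z : ℂ) :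
    L.weierstrassP z = 1 / z ^ 2 + L.weierstrassPExcept 0 z := by
  have := L.weierstrassPExcept_add 0 z
  simp at this
  rw [← this]
  simp [add_comm]

theorem derivWeierstrassP_eq_inv_cube_add (z : ℂ) :
    L.derivWeierstrassP z = -2 / z ^ 3 + L.derivWeierstrassPExcept 0 z := by
  have := L.derivWeierstrassPExcept_sub 0 z
  simp at this
  rw [← this]
  ring

theorem eventually_sub_notMem_lattice {X Y : ℂ} (h : X - Y ∉ L.lattice) :
    ∀ᶠ z in 𝓝 X, z - Y ∉ L.lattice :=
  (continuous_sub_right Y).continuousAt.eventually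
    (L.isClosed_lattice.isOpen_compl.mem_nhds h)

theorem eventually_sub_self_notMem_lattice (X : ℂ) :
    ∀ᶠ z in 𝓝[≠] X, z - X ∉ L.lattice := by
  have h1 : ∀ᶠ z in 𝓝 X, z - X ∈ ((L.lattice : Set ℂ) \ {0})ᶜ := by
    refine (continuous_sub_right X).continuousAt.eventually ?_
    simp only [sub_self]
    exact L.compl_lattice_sdiff_singleton_mem_nhds 0
  filter_upwards [nhdsWithin_le_nhds h1, self_mem_nhdsWithin] with z hz hzX hmem
  exact hz ⟨hmem, sub_ne_zero.2 hzX⟩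

theorem eventually_forall_sub_notMem_lattice {N : ℕ} {X : Fin N → ℂ}
    (hX : ∀ j k, j ≠ k → X j - X k ∉ L.lattice) (i : Fin N) :
    ∀ᶠ z in 𝓝[≠] X i, ∀ j, z - X j ∉ L.lattice := by
  rw [eventually_all]
  intro j
  rcases eq_or_ne j i with rfl | hj
  · exact L.eventually_sub_self_notMem_lattice _
  · exact nhdsWithin_le_nhds (L.eventually_sub_notMem_lattice (hX i j hj.symm))

theorem tendsto_cube_mul_derivWeierstrassP :
    Tendsto (fun w : ℂ => w ^ 3 * L.derivWeierstrassP w) (𝓝[≠] 0) (𝓝 (-2)) := by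
  have h1 : Tendsto (fun w : ℂ => -2 + w ^ 3 * L.derivWeierstrassPExcept 0 w) (𝓝[≠] 0)
      (𝓝 (-2 + 0 ^ 3 * L.derivWeierstrassPExcept 0 0)) := by
    have : ContinuousAt (fun w : ℂ => -2 + w ^ 3 * L.derivWeierstrassPExcept 0 w) 0 :=
      continuousAt_const.add ((continuousAt_id.pow 3).mul
        (L.analyticAt_derivWeierstrassPExcept 0).continuousAt)
    exact this.tendsto.mono_left nhdsWithin_le_nhds
  have e : (-2 + 0 ^ 3 * L.derivWeierstrassPExcept 0 0 : ℂ) = -2 := by simp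
  rw [e] at h1
  refine h1.congr' ?_
  filter_upwards [self_mem_nhdsWithin] with w hw
  have hw' : w ≠ 0 := hw
  rw [L.derivWeierstrassP_eq_inv_cube_add]
  field_simp

/-- For incongruent `X j`, some matrix `℘' (z i - X j)` is invertible. -/
theorem exists_det_derivWeierstrassP_ne_zero {N : ℕ} {X : Fin N → ℂ}
    (hX : ∀ j k, j ≠ k → X j - X k ∉ L.lattice) :
    ∃ z : Fin N → ℂ, (∀ i j, z i - X j ∉ L.lattice) ∧
      (Matrix.of fun i j => L.derivWeierstrassP (z i - X j)).det ≠ 0 := by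
  -- Sampling at `z i = X i + h` makes the poles on the diagonal dominate: scaled by `h ^ 3`, the
  -- matrix tends to `-2` times the identity.
  have hlim : Tendsto (fun h : ℂ => Matrix.of fun i j : Fin N =>
      h ^ 3 * L.derivWeierstrassP (X i + h - X j)) (𝓝[≠] 0)
      (𝓝 (Matrix.diagonal fun _ => (-2 : ℂ))) := by
    refine tendsto_pi_nhds.2 fun i => tendsto_pi_nhds.2 fun j => ?_
    rcases eq_or_ne i j with rfl | hij
    · simpa using L.tendsto_cube_mul_derivWeierstrassP
    · rw [Matrix.diagonal_apply_ne _ hij]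
      have hc : ContinuousAt (fun h : ℂ => h ^ 3 * L.derivWeierstrassP (X i + h - X j)) 0 := by
        refine (continuousAt_id.pow 3).mul (ContinuousAt.comp (g := L.derivWeierstrassP)
          (f := fun h : ℂ => X i + h - X j) ?_ (by fun_prop))
        refine (L.differentiableOn_derivWeierstrassP.differentiableAt
          (L.isClosed_lattice.isOpen_compl.mem_nhds ?_)).continuousAt
        simpa using hX i j hij
      have := hc.tendsto
      simp only [ne_eq, OfNat.ofNat_ne_zero, not_false_eq_true, zero_pow, zero_mul] at this
      exact this.mono_left nhdsWithin_le_nhds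
  have hdet := ((Continuous.matrix_det continuous_id).tendsto _).comp hlim
  have h1 : ∀ᶠ h : ℂ in 𝓝[≠] 0, (Matrix.of fun i j : Fin N =>
      h ^ 3 * L.derivWeierstrassP (X i + h - X j)).det ≠ 0 :=
    hdet.eventually_ne (by simp [Matrix.det_diagonal])
  have h2 : ∀ᶠ h : ℂ in 𝓝[≠] 0, ∀ i j, X i + h - X j ∉ L.lattice := by
    rw [eventually_all]
    intro i
    have ht : Tendsto (fun h : ℂ => X i + h) (𝓝[≠] 0) (𝓝[≠] (X i)) := by
      refine tendsto_nhdsWithin_iff.2 ⟨?_, ?_⟩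
      · have : Tendsto (fun h : ℂ => X i + h) (𝓝 0) (𝓝 (X i + 0)) :=
          (continuous_const_add (X i)).tendsto 0
        rw [add_zero] at this
        exact this.mono_left nhdsWithin_le_nhds
      · filter_upwards [self_mem_nhdsWithin] with h hh
        simpa using hh
    exact ht.eventually (L.eventually_forall_sub_notMem_lattice hX i)
  obtain ⟨h, hd, hn⟩ := (h1.and h2).exists
  refine ⟨fun i => X i + h, hn, fun h0 => hd ?_⟩
  have : (Matrix.of fun i j : Fin N => h ^ 3 * L.derivWeierstrassP (X i + h - X j)) =
      h ^ 3 • Matrix.of fun i j => L.derivWeierstrassP (X i + h - X j) := by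
    ext i j; simp
  rw [this, Matrix.det_smul, h0, mul_zero]

end PeriodPair

/-! ### Differentiability and dynamics of the poles -/

namespace PeriodPair

variable (L : PeriodPair)

/-- `dslope` replaces the difference quotient because `x s = x t` may occur for `s ≠ t`. -/
theorem tendsto_dslope_weierstrassP {x : ℝ → ℂ} {t : ℝ} {z : ℂ} (hx : ContinuousAt x t)
    (hz : z - x t ∉ L.lattice) :
    Tendsto (fun s => dslope (fun w => L.weierstrassP (z - w)) (x t) (x s)) (𝓝 t)
      (𝓝 (-L.derivWeierstrassP (z - x t))) := by
  have hd : HasDerivAt (fun w => L.weierstrassP (z - w)) (-L.derivWeierstrassP (z - x t)) (x t) :=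
    (L.hasDerivAt_weierstrassP hz).comp_const_sub z (x t)
  have h1 := (continuousAt_dslope_same.2 hd.differentiableAt).tendsto
  rw [dslope_same, hd.deriv] at h1
  exact h1.comp hx

/-- Continuous poles are differentiable if the potential is. -/
theorem differentiableAt_poles {N : ℕ} {x : Fin N → ℝ → ℂ} {u : ℂ → ℝ → ℂ} {t : ℝ}
    (hx : ∀ j, ContinuousAt (x j) t) (hne : ∀ j k, j ≠ k → x j t - x k t ∉ L.lattice)
    (hu : ∀ᶠ s in 𝓝 t, ∀ z, (∀ j, z - x j s ∉ L.lattice) →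
      u z s = ∑ j, 2 * L.weierstrassP (z - x j s))
    (hd : ∀ z, (∀ j, z - x j t ∉ L.lattice) → DifferentiableAt ℝ (u z) t) (i : Fin N) :
    DifferentiableAt ℝ (x i) t := by
  obtain ⟨z, hz, hdet⟩ := L.exists_det_derivWeierstrassP_ne_zero (X := fun j => x j t) hne
  -- The difference quotients of `u` at the points `z i` are `A s` applied to those of the poles.
  -- Since `A s` tends to the invertible matrix `B`, the latter converge too.
  set A : ℝ → Matrix (Fin N) (Fin N) ℂ := fun s => Matrix.of fun i j =>
    2 * dslope (fun w => L.weierstrassP (z i - w)) (x j t) (x j s) with hA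
  set B : Matrix (Fin N) (Fin N) ℂ :=
    Matrix.of fun i j => 2 * -L.derivWeierstrassP (z i - x j t) with hB
  have hAB : Tendsto A (𝓝 t) (𝓝 B) := tendsto_pi_nhds.2 fun i => tendsto_pi_nhds.2 fun j =>
    (L.tendsto_dslope_weierstrassP (hx j) (hz i j)).const_mul 2
  have hBdet : B.det ≠ 0 := by
    have : B = (-2 : ℂ) • Matrix.of fun i j => L.derivWeierstrassP (z i - x j t) := by
      ext i j; simp [hB]
    rw [this, Matrix.det_smul]
    exact mul_ne_zero (pow_ne_zero _ (by norm_num)) hdet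
  have hAdet : ∀ᶠ s in 𝓝 t, (A s).det ≠ 0 :=
    (((Continuous.matrix_det continuous_id).tendsto B).comp hAB).eventually_ne hBdet
  have hpole : ∀ᶠ s in 𝓝 t, ∀ i j, z i - x j s ∉ L.lattice := by
    simp only [eventually_all]
    exact fun i j => (continuousAt_const.sub (hx j)).eventually
      (L.isClosed_lattice.isOpen_compl.mem_nhds (hz i j))
  set v : ℝ → Fin N → ℂ := fun s i => slope (u (z i)) t s with hv
  have hvlim : Tendsto v (𝓝[≠] t) (𝓝 fun i => deriv (u (z i)) t) :=
    tendsto_pi_nhds.2 fun i => hasDerivAt_iff_tendsto_slope.1 (hd (z i) (hz i)).hasDerivAt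
  have hAinv : Tendsto (fun s => (A s)⁻¹) (𝓝[≠] t) (𝓝 B⁻¹) := by
    have h1 : ContinuousAt (fun M : Matrix (Fin N) (Fin N) ℂ => M⁻¹) B := by
      simp only [Matrix.inv_def, Ring.inverse_eq_inv']
      exact ((Continuous.matrix_det continuous_id).continuousAt.inv₀ hBdet).smul
        (Continuous.matrix_adjugate continuous_id).continuousAt
    exact (h1.tendsto.comp hAB).mono_left nhdsWithin_le_nhds
  have hlim : Tendsto (fun s => ((A s)⁻¹.mulVec (v s)) i) (𝓝[≠] t)
      (𝓝 ((B⁻¹.mulVec fun i => deriv (u (z i)) t) i)) := by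
    simp only [Matrix.mulVec, dotProduct]
    exact tendsto_finsetSum _ fun j _ =>
      ((tendsto_pi_nhds.1 ((tendsto_pi_nhds.1 hAinv) i)) j).mul ((tendsto_pi_nhds.1 hvlim) j)
  refine (hasDerivAt_iff_tendsto_slope.2 (hlim.congr' ?_)).differentiableAt
  filter_upwards [nhdsWithin_le_nhds hAdet, nhdsWithin_le_nhds hpole, nhdsWithin_le_nhds hu]
    with s hs hps hus
  have hmul : v s = (A s).mulVec fun j => slope (x j) t s := by
    ext i
    simp only [hv, slope_def_module, Matrix.mulVec, dotProduct, hA, Matrix.of_apply]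
    rw [hus _ (hps i), hu.self_of_nhds _ (hz i), ← Finset.sum_sub_distrib, Finset.smul_sum]
    refine Finset.sum_congr rfl fun j _ => ?_
    have := sub_smul_dslope (fun w => L.weierstrassP (z i - w)) (x j t) (x j s)
    simp only [smul_eq_mul] at this
    rw [← mul_sub, ← this, Complex.real_smul, Complex.real_smul]
    ring
  rw [hmul, Matrix.mulVec_mulVec, Matrix.nonsing_inv_mul _ (isUnit_iff_ne_zero.2 hs),
    Matrix.one_mulVec]

/-- The poles of an elliptic KdV solution move by the Calogero-Moser flow and stay on its
locus. -/
theorem pole_dynamics {N : ℕ} {x : Fin N → ℝ → ℂ} {u : ℂ → ℝ → ℂ} {t : ℝ}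
    (hx : ∀ j, ContinuousAt (x j) t) (hne : ∀ j k, j ≠ k → x j t - x k t ∉ L.lattice)
    (hu : ∀ᶠ s in 𝓝 t, ∀ z, (∀ j, z - x j s ∉ L.lattice) →
      u z s = ∑ j, 2 * L.weierstrassP (z - x j s))
    (hkdv : ∀ z, (∀ j, z - x j t ∉ L.lattice) → KdVAt u z t) (i : Fin N) :
    HasDerivAt (x i) (-12 * ∑ k ∈ Finset.univ.erase i, L.weierstrassP (x i t - x k t)) t ∧
      ∑ k ∈ Finset.univ.erase i, L.derivWeierstrassP (x i t - x k t) = 0 := by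
  have hd := L.differentiableAt_poles hx hne hu fun z hz => (hkdv z hz).differentiableAt
  set X : Fin N → ℂ := fun j => x j t with hX
  -- `G` and `k` are the regular parts at `X i` of the potential and of its time derivative.
  set G : ℂ → ℂ := fun z => 2 * L.weierstrassPExcept 0 (z - X i) +
    ∑ k ∈ Finset.univ.erase i, 2 * L.weierstrassP (z - X k) with hG
  set k : ℂ → ℂ := fun z => -2 * L.derivWeierstrassPExcept 0 (z - X i) * deriv (x i) t +
    ∑ j ∈ Finset.univ.erase i, -2 * L.derivWeierstrassP (z - X j) * deriv (x j) t with hk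
  have hEa : AnalyticAt ℂ (fun z => L.weierstrassPExcept 0 (z - X i)) (X i) := by
    refine AnalyticAt.comp (g := L.weierstrassPExcept 0) (f := fun z => z - X i) ?_ (by fun_prop)
    rw [sub_self]
    exact L.analyticAt_weierstrassPExcept 0
  have hnm : ∀ j ∈ Finset.univ.erase i, X i - X j ∉ L.lattice := fun j hj =>
    hne i j (Finset.ne_of_mem_erase hj).symm
  have hGa : AnalyticAt ℂ G (X i) := by
    refine (analyticAt_const.mul hEa).add (Finset.analyticAt_fun_sum _ fun j hj => ?_)
    exact analyticAt_const.mul (AnalyticAt.comp (g := L.weierstrassP) (f := fun z => z - X j)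
      (L.analyticOnNhd_weierstrassP _ (hnm j hj)) (by fun_prop))
  have hkc : ContinuousAt k (X i) := by
    refine ContinuousAt.add ?_ (tendsto_finsetSum _ fun j hj => ?_)
    · refine (continuousAt_const.mul ?_).mul continuousAt_const
      refine ContinuousAt.comp (g := L.derivWeierstrassPExcept 0) (f := fun z => z - X i) ?_
        (by fun_prop)
      rw [sub_self]
      exact (L.analyticAt_derivWeierstrassPExcept 0).continuousAt
    · refine ((tendsto_const_nhds.mul ?_).mul tendsto_const_nhds)
      exact ContinuousAt.tendsto (ContinuousAt.comp (g := L.derivWeierstrassP)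
        (f := fun z => z - X j)
        (L.analyticOnNhd_derivWeierstrassP _ (hnm j hj)).continuousAt (by fun_prop))
  have hnp := L.eventually_forall_sub_notMem_lattice (X := X) hne i
  have hf : ∀ᶠ z in 𝓝[≠] X i, u z t = 2 / (z - X i) ^ 2 + G z := by
    filter_upwards [hnp] with z hz
    rw [hu.self_of_nhds z hz, ← Finset.add_sum_erase _ _ (Finset.mem_univ i),
      L.weierstrassP_eq_inv_sq_add]
    simp only [hG]
    ring
  have heq : ∀ᶠ z in 𝓝[≠] X i, 4 * deriv (x i) t / (z - X i) ^ 3 + k z =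
      6 * u z t * deriv (fun y => u y t) z - iteratedDeriv 3 (fun y => u y t) z := by
    filter_upwards [hnp] with z hz
    have h1 := hkdv z hz
    have h2 : HasDerivAt (fun s => ∑ j, 2 * L.weierstrassP (z - x j s))
        (∑ j, 2 * (L.derivWeierstrassP (z - x j t) * -deriv (x j) t)) t :=
      HasDerivAt.fun_sum fun j _ => (HasDerivAt.comp (h₂ := L.weierstrassP)
        (h := fun s => z - x j s) t (L.hasDerivAt_weierstrassP (hz j))
        ((hd j).hasDerivAt.const_sub z)).const_mul 2
    have h3 : (fun s => u z s) =ᶠ[𝓝 t] fun s => ∑ j, 2 * L.weierstrassP (z - x j s) := by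
      have hev : ∀ᶠ s in 𝓝 t, ∀ j, z - x j s ∉ L.lattice := by
        rw [eventually_all]
        exact fun j => (continuousAt_const.sub (hx j)).eventually
          (L.isClosed_lattice.isOpen_compl.mem_nhds (hz j))
      filter_upwards [hu, hev] with s hs hs' using hs z hs'
    rw [HasDerivAt.unique h1 (h2.congr_of_eventuallyEq h3),
      ← Finset.add_sum_erase _ _ (Finset.mem_univ i), L.derivWeierstrassP_eq_inv_cube_add]
    simp only [hk]
    rw [← add_assoc]
    congr 1
    · simp only [hX]; ring
    · exact Finset.sum_congr rfl fun j _ => by simp only [hX]; ring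
  obtain ⟨hc, hg⟩ := kdv_local (f := fun z => u z t) hGa hkc hf heq
  constructor
  · have := (hd i).hasDerivAt
    rw [hc] at this
    refine this.congr_deriv ?_
    simp only [hG, sub_self, L.weierstrassPExcept_zero, ← Finset.mul_sum]
    ring
  · have hE : HasDerivAt (fun z => L.weierstrassPExcept 0 (z - X i)) 0 (X i) := by
      have h0 : HasDerivAt (L.weierstrassPExcept 0) 0 (X i - X i) := by
        rw [sub_self]
        simpa using (L.analyticAt_weierstrassPExcept 0).differentiableAt.hasDerivAt
      exact h0.comp_sub_const (X i) (X i)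
    have hG' : HasDerivAt G (2 * 0 + ∑ k ∈ Finset.univ.erase i,
        2 * L.derivWeierstrassP (X i - X k)) (X i) :=
      (hE.const_mul 2).add (HasDerivAt.fun_sum fun j hj =>
        ((L.hasDerivAt_weierstrassP (hnm j hj)).comp_sub_const (X i) (X j)).const_mul 2)
    rw [hG'.deriv] at hg
    simp only [mul_zero, zero_add, ← Finset.mul_sum] at hg
    simpa using hg

end PeriodPair

/-! ### Evolution of the power sums -/

theorem sum_sum_ne_comm {N : ℕ} (g : Fin N → Fin N → ℂ) :
    ∑ j, ∑ k ∈ Finset.univ.erase j, g j k = ∑ j, ∑ k ∈ Finset.univ.erase j, g k j := by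
  rw [sum_sum_ne_eq, sum_sum_ne_eq, Finset.sum_comm]

namespace PeriodPair

variable (L : PeriodPair)

/-- The contribution of the regular part of `℘` to the interaction of two poles, tested against
`z ^ m`. -/
noncomputable def pairRemainder (m : ℕ) (a b : ℂ) : ℂ :=
  m * (a ^ (m - 1) + b ^ (m - 1)) * L.weierstrassPExcept 0 (a - b) +
    (a ^ m - b ^ m) * L.derivWeierstrassPExcept 0 (a - b)

theorem pairKernel_add_pairRemainder (m : ℕ) {a b : ℂ} (h : a ≠ b) :
    pairKernel m a b + L.pairRemainder m a b =
      m * (a ^ (m - 1) + b ^ (m - 1)) * L.weierstrassP (a - b) +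
        (a ^ m - b ^ m) * L.derivWeierstrassP (a - b) := by
  have hab : a - b ≠ 0 := sub_ne_zero.2 h
  have hk : pairKernel m a b =
      (m * (a ^ (m - 1) + b ^ (m - 1)) * (a - b) - 2 * (a ^ m - b ^ m)) / (a - b) ^ 3 := by
    rw [eq_div_iff (pow_ne_zero 3 hab), ← cube_sub_mul_pairKernel]
    ring
  rw [hk, pairRemainder, L.weierstrassP_eq_inv_sq_add, L.derivWeierstrassP_eq_inv_cube_add]
  field_simp
  ring

/-- The `℘` terms are symmetrized over pairs since `℘` is even. The `℘'` terms that make the poles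
cancel may be added because they vanish by the locus equations `hl`. -/
theorem hasDerivAt_sum_pow {N : ℕ} {x : Fin N → ℝ → ℂ} {t : ℝ} (hne : ∀ j k, j ≠ k → x j t ≠ x k t)
    (hd : ∀ i,
      HasDerivAt (x i) (-12 * ∑ k ∈ Finset.univ.erase i, L.weierstrassP (x i t - x k t)) t)
    (hl : ∀ i, ∑ k ∈ Finset.univ.erase i, L.derivWeierstrassP (x i t - x k t) = 0) (m : ℕ) :
    HasDerivAt (fun s => ∑ j, x j s ^ m)
      (-6 * ∑ j, ∑ k ∈ Finset.univ.erase j, pairKernel m (x j t) (x k t) +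
        -6 * ∑ j, ∑ k ∈ Finset.univ.erase j, L.pairRemainder m (x j t) (x k t)) t := by
  refine (HasDerivAt.fun_sum fun j _ => (hd j).pow m).congr_deriv ?_
  have h1 : ∑ j, ∑ k ∈ Finset.univ.erase j, m * x j t ^ (m - 1) * L.weierstrassP (x j t - x k t) =
      ∑ j, ∑ k ∈ Finset.univ.erase j, m * x k t ^ (m - 1) * L.weierstrassP (x j t - x k t) := by
    rw [sum_sum_ne_comm]
    refine Finset.sum_congr rfl fun j _ => Finset.sum_congr rfl fun k _ => ?_
    rw [← L.weierstrassP_neg, neg_sub]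
  have h2 : ∑ j, ∑ k ∈ Finset.univ.erase j, x j t ^ m * L.derivWeierstrassP (x j t - x k t) = 0 := by
    refine Finset.sum_eq_zero fun j _ => ?_
    rw [← Finset.mul_sum, hl, mul_zero]
  have h3 : ∑ j, ∑ k ∈ Finset.univ.erase j, x k t ^ m * L.derivWeierstrassP (x j t - x k t) = 0 := by
    rw [sum_sum_ne_comm, ← neg_eq_zero, ← h2]
    simp only [← Finset.sum_neg_distrib]
    refine Finset.sum_congr rfl fun j _ => Finset.sum_congr rfl fun k _ => ?_
    rw [← neg_sub (x j t), L.derivWeierstrassP_neg]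
    ring
  have h4 : ∑ j, ∑ k ∈ Finset.univ.erase j, pairKernel m (x j t) (x k t) +
      ∑ j, ∑ k ∈ Finset.univ.erase j, L.pairRemainder m (x j t) (x k t) =
      (∑ j, ∑ k ∈ Finset.univ.erase j, m * x j t ^ (m - 1) * L.weierstrassP (x j t - x k t) +
      ∑ j, ∑ k ∈ Finset.univ.erase j, m * x k t ^ (m - 1) * L.weierstrassP (x j t - x k t)) +
      (∑ j, ∑ k ∈ Finset.univ.erase j, x j t ^ m * L.derivWeierstrassP (x j t - x k t) -
      ∑ j, ∑ k ∈ Finset.univ.erase j, x k t ^ m * L.derivWeierstrassP (x j t - x k t)) := by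
    simp only [← Finset.sum_add_distrib, ← Finset.sum_sub_distrib]
    refine Finset.sum_congr rfl fun j _ => Finset.sum_congr rfl fun k hk => ?_
    rw [L.pairKernel_add_pairRemainder m (hne j k (Finset.ne_of_mem_erase hk).symm)]
    ring
  rw [← mul_add, h4, h2, h3, ← h1, sub_zero, add_zero, ← two_mul, ← mul_assoc, Finset.mul_sum]
  refine Finset.sum_congr rfl fun j _ => ?_
  rw [← Finset.mul_sum]
  ring

/-- Near zero the regular part of `℘` is `O(z)`, which restores the power missing in `a ^ (m - 1)`,
and its derivative is bounded. -/
theorem exists_norm_pairRemainder_le :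
    ∃ r : ℝ, 0 < r ∧ ∀ m : ℕ, 1 ≤ m → ∃ C : ℝ, 0 ≤ C ∧ ∀ (a b : ℂ) (S : ℝ), S ≤ r → ‖a‖ ≤ S →
      ‖b‖ ≤ S → ‖L.pairRemainder m a b‖ ≤ C * S ^ m := by
  have hH := (L.analyticAt_weierstrassPExcept 0).differentiableAt.hasDerivAt.isBigO_sub
  simp only [L.weierstrassPExcept_zero, sub_zero] at hH
  obtain ⟨A, hA, hAb⟩ := hH.exists_pos
  have hD := (L.analyticAt_derivWeierstrassPExcept 0).continuousAt.norm.eventually_lt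
    (continuousAt_const (y := ‖L.derivWeierstrassPExcept 0 0‖ + 1)) (lt_add_one _)
  set B := ‖L.derivWeierstrassPExcept 0 0‖ + 1 with hB
  have hB0 : 0 ≤ B := by positivity
  obtain ⟨ρ, hρ, hball⟩ := Metric.eventually_nhds_iff.1 (hAb.bound.and hD)
  refine ⟨ρ / 3, by positivity, fun m hm => ⟨4 * m * A + 2 * B, by positivity,
    fun a b S hS ha hb => ?_⟩⟩
  have hS0 : 0 ≤ S := (norm_nonneg a).trans ha
  have hd : ‖a - b‖ ≤ 2 * S := (norm_sub_le a b).trans (by linarith)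
  obtain ⟨h1, h2⟩ := @hball (a - b) (by rw [dist_zero_right]; linarith)
  have h1' : ‖L.weierstrassPExcept 0 (a - b)‖ ≤ A * (2 * S) := h1.trans (by gcongr)
  have hp : ‖(m : ℂ) * (a ^ (m - 1) + b ^ (m - 1))‖ ≤ m * (S ^ (m - 1) + S ^ (m - 1)) := by
    rw [norm_mul, Complex.norm_natCast]
    refine mul_le_mul_of_nonneg_left ((norm_add_le _ _).trans ?_) (by positivity)
    rw [norm_pow, norm_pow]
    gcongr
  have hq : ‖a ^ m - b ^ m‖ ≤ S ^ m + S ^ m := by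
    refine (norm_sub_le _ _).trans ?_
    rw [norm_pow, norm_pow]
    gcongr
  calc ‖L.pairRemainder m a b‖
      ≤ m * (S ^ (m - 1) + S ^ (m - 1)) * (A * (2 * S)) + (S ^ m + S ^ m) * B := by
        refine (norm_add_le _ _).trans ?_
        rw [norm_mul, norm_mul (a ^ m - b ^ m)]
        gcongr
    _ = (4 * m * A + 2 * B) * S ^ m := by
        obtain ⟨n, rfl⟩ : ∃ n, m = n + 1 := ⟨m - 1, by lia⟩
        simp only [Nat.add_sub_cancel]
        ring

end PeriodPair

/-! ### The cube root scale and L'Hôpital's rule -/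

/-- The real cube root. -/
noncomputable def cubeRoot (t : ℝ) : ℝ := t ^ (1 / 3 : ℝ)

theorem cubeRoot_pos {t : ℝ} (ht : 0 < t) : 0 < cubeRoot t := Real.rpow_pos_of_pos ht _

theorem cubeRoot_pow_three {t : ℝ} (ht : 0 ≤ t) : cubeRoot t ^ 3 = t := by
  rw [cubeRoot, ← Real.rpow_natCast, ← Real.rpow_mul ht]
  norm_num

theorem continuous_cubeRoot : Continuous cubeRoot :=
  Real.continuous_rpow_const (by norm_num)

theorem tendsto_cubeRoot : Tendsto cubeRoot (𝓝[>] 0) (𝓝 0) := by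
  have := continuous_cubeRoot.tendsto 0
  rw [show cubeRoot 0 = 0 by simp [cubeRoot]] at this
  exact this.mono_left nhdsWithin_le_nhds

theorem hasDerivAt_cubeRoot_pow {t : ℝ} (ht : 0 < t) (m : ℕ) :
    HasDerivAt (fun s => cubeRoot s ^ m) (m / 3 * (cubeRoot t ^ m / cubeRoot t ^ 3)) t := by
  have h1 : HasDerivAt cubeRoot (1 / 3 * t ^ (1 / 3 - 1 : ℝ)) t :=
    Real.hasDerivAt_rpow_const (Or.inl ht.ne')
  refine (h1.pow m).congr_deriv ?_
  rw [Real.rpow_sub ht, Real.rpow_one, cubeRoot_pow_three ht.le]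
  change m * cubeRoot t ^ (m - 1) * (1 / 3 * (cubeRoot t / t)) = _
  rcases m with _ | m
  · simp
  · simp only [Nat.add_sub_cancel]
    field_simp
    ring

theorem tendsto_div_cubeRoot_pow_real {f f' : ℝ → ℝ} {m : ℕ} (hm : 1 ≤ m) {A : ℝ}
    (hf : ∀ᶠ t in 𝓝[>] 0, HasDerivAt f (f' t) t) (hf0 : Tendsto f (𝓝[>] 0) (𝓝 0))
    (h : Tendsto (fun t => f' t * (cubeRoot t ^ 3 / cubeRoot t ^ m)) (𝓝[>] 0) (𝓝 A)) :
    Tendsto (fun t => f t / cubeRoot t ^ m) (𝓝[>] 0) (𝓝 (3 / m * A)) := by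
  have hm0 : (0 : ℝ) < m := by exact_mod_cast hm
  refine HasDerivAt.lhopital_zero_nhdsGT (f' := f') (g := fun t => cubeRoot t ^ m)
    (g' := fun t => m / 3 * (cubeRoot t ^ m / cubeRoot t ^ 3)) hf ?_ ?_ hf0 ?_ ?_
  · filter_upwards [self_mem_nhdsWithin] with t ht using hasDerivAt_cubeRoot_pow ht m
  · filter_upwards [self_mem_nhdsWithin] with t ht
    have := cubeRoot_pos ht
    positivity
  · simpa [show m ≠ 0 by lia] using tendsto_cubeRoot.pow m
  · refine (h.const_mul (3 / (m : ℝ))).congr' ?_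
    filter_upwards [self_mem_nhdsWithin] with t ht
    have := cubeRoot_pos ht
    field_simp

/-- L'Hôpital's rule for a complex function and a power of the cube root. -/
theorem tendsto_div_cubeRoot_pow {f f' : ℝ → ℂ} {m : ℕ} (hm : 1 ≤ m) {A : ℂ}
    (hf : ∀ᶠ t in 𝓝[>] 0, HasDerivAt f (f' t) t) (hf0 : Tendsto f (𝓝[>] 0) (𝓝 0))
    (h : Tendsto (fun t => f' t * ((cubeRoot t : ℂ) ^ 3 / (cubeRoot t : ℂ) ^ m)) (𝓝[>] 0) (𝓝 A)) :
    Tendsto (fun t => f t / (cubeRoot t : ℂ) ^ m) (𝓝[>] 0) (𝓝 (3 / m * A)) := by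
  have hre := tendsto_div_cubeRoot_pow_real (f := fun t => (f t).re) (f' := fun t => (f' t).re) hm
    (A := A.re) (hf.mono fun t ht => Complex.reCLM.hasFDerivAt.comp_hasDerivAt t ht)
    ((Complex.continuous_re.tendsto 0).comp hf0)
    (((Complex.continuous_re.tendsto A).comp h).congr fun t => by
      simp only [Function.comp, ← Complex.ofReal_pow, ← Complex.ofReal_div, Complex.re_mul_ofReal])
  have him := tendsto_div_cubeRoot_pow_real (f := fun t => (f t).im) (f' := fun t => (f' t).im) hm
    (A := A.im) (hf.mono fun t ht => Complex.imCLM.hasFDerivAt.comp_hasDerivAt t ht)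
    ((Complex.continuous_im.tendsto 0).comp hf0)
    (((Complex.continuous_im.tendsto A).comp h).congr fun t => by
      simp only [Function.comp, ← Complex.ofReal_pow, ← Complex.ofReal_div, Complex.im_mul_ofReal])
  have h3 := ((Complex.continuous_ofReal.tendsto _).comp hre).add
    (((Complex.continuous_ofReal.tendsto _).comp him).mul_const Complex.I)
  have e : ((3 / m * A.re : ℝ) : ℂ) + ((3 / m * A.im : ℝ) : ℂ) * Complex.I = 3 / m * A := by
    push_cast
    linear_combination (3 / m : ℂ) * Complex.re_add_im A
  rw [e] at h3
  refine h3.congr fun t => ?_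
  simp only [Function.comp]
  push_cast
  linear_combination (1 / (cubeRoot t : ℂ) ^ m) * Complex.re_add_im (f t)

/-! ### A priori bound and rescaled power sums -/

/-- Points whose power sums evolve as for the rational Calogero-Moser locus, up to a remainder of
higher order. -/
structure IsPerturbedRationalFlow {N : ℕ} (x : Fin N → ℝ → ℂ) (δ : ℝ) (R : ℕ → ℝ → ℂ) : Prop where
  pos : 0 < δ
  zero : ∀ j, x j 0 = 0
  continuousOn : ∀ j, ContinuousOn (x j) (Set.Ico 0 δ)
  norm_le_one : ∀ t ∈ Set.Ico 0 δ, ‖fun j => x j t‖ ≤ 1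
  hasDerivAt : ∀ m, 1 ≤ m → ∀ t ∈ Set.Ioo 0 δ, HasDerivAt (fun s => ∑ j, x j s ^ m)
    (-6 * ∑ j, ∑ k ∈ Finset.univ.erase j, pairKernel m (x j t) (x k t) + R m t) t
  remainder : ∀ m, 1 ≤ m → ∃ C : ℝ, 0 ≤ C ∧
    ∀ t ∈ Set.Ioo 0 δ, ‖R m t‖ ≤ C * ‖fun j => x j t‖ ^ m

/-- The mean value inequality on `[η, b]` with `η → 0`, as nothing is known about a derivative at
`0`. -/
theorem norm_le_mul_of_norm_deriv_le {f f' : ℝ → ℂ} {b C : ℝ} (hb : 0 < b)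
    (hc : ContinuousWithinAt f (Set.Ici 0) 0) (h0 : f 0 = 0)
    (hf : ∀ t ∈ Set.Ioc 0 b, HasDerivAt f (f' t) t) (hC : ∀ t ∈ Set.Ioc 0 b, ‖f' t‖ ≤ C) :
    ‖f b‖ ≤ C * b := by
  have h1 : ∀ᶠ η in 𝓝[>] (0 : ℝ), ‖f b - f η‖ ≤ C * (b - η) := by
    filter_upwards [Ioo_mem_nhdsGT hb] with η hη
    refine norm_image_sub_le_of_norm_deriv_le_segment' (f' := f') (a := η) (b := b)
      (fun s hs => (hf s ⟨hη.1.trans_le hs.1, hs.2⟩).hasDerivWithinAt)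
      (fun s hs => hC s ⟨hη.1.trans_le hs.1, hs.2.le⟩) b ⟨hη.2.le, le_rfl⟩
  have h2 : Tendsto f (𝓝[>] 0) (𝓝 0) := by
    have := hc.tendsto
    rw [h0] at this
    exact this.mono_left (nhdsWithin_mono _ Set.Ioi_subset_Ici_self)
  have h3 : Tendsto (fun η : ℝ => η) (𝓝[>] 0) (𝓝 0) := nhdsWithin_le_nhds
  have := le_of_tendsto_of_tendsto (h2.const_sub (f b)).norm ((h3.const_sub b).const_mul C) h1
  simpa using this

namespace IsPerturbedRationalFlow

variable {N : ℕ} {x : Fin N → ℝ → ℂ} {δ : ℝ} {R : ℕ → ℝ → ℂ}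

theorem continuousWithinAt_zero (h : IsPerturbedRationalFlow x δ R) (j : Fin N) :
    ContinuousWithinAt (x j) (Set.Ici 0) 0 :=
  ((h.continuousOn j) 0 ⟨le_rfl, h.pos⟩).mono_of_mem_nhdsWithin (Ico_mem_nhdsGE h.pos)

theorem norm_deriv_le (h : IsPerturbedRationalFlow x δ R) {m : ℕ} (hm : 1 ≤ m) :
    ∃ C : ℝ, 0 ≤ C ∧ ∀ t ∈ Set.Ioo 0 δ, ∀ S ≤ 1, ‖fun j => x j t‖ ≤ S →
      S ^ 3 * ‖-6 * ∑ j, ∑ k ∈ Finset.univ.erase j, pairKernel m (x j t) (x k t) + R m t‖ ≤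
        C * S ^ m := by
  obtain ⟨C, hC, hR⟩ := h.remainder m hm
  obtain ⟨D, hD, hK⟩ := exists_norm_pairKernel_le m
  refine ⟨6 * (∑ j : Fin N, ∑ k ∈ Finset.univ.erase j, D) + C, ?_, fun t ht S hS1 hS => ?_⟩
  · exact add_nonneg (mul_nonneg (by norm_num) (Finset.sum_nonneg fun _ _ =>
      Finset.sum_nonneg fun _ _ => hD)) hC
  have hS0 : 0 ≤ S := (norm_nonneg _).trans hS
  have hx : ∀ j, ‖x j t‖ ≤ S := fun j => (norm_le_pi_norm (fun j => x j t) j).trans hS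
  have h1 : S ^ 3 * ‖∑ j, ∑ k ∈ Finset.univ.erase j, pairKernel m (x j t) (x k t)‖ ≤
      (∑ j : Fin N, ∑ k ∈ Finset.univ.erase j, D) * S ^ m := by
    refine (mul_le_mul_of_nonneg_left ((norm_sum_le _ _).trans
      (Finset.sum_le_sum fun j _ => norm_sum_le _ _)) (by positivity)).trans ?_
    rw [Finset.mul_sum, Finset.sum_mul]
    refine Finset.sum_le_sum fun j _ => ?_
    rw [Finset.mul_sum, Finset.sum_mul]
    exact Finset.sum_le_sum fun k _ => hK _ _ _ (hx j) (hx k)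
  have h2 : S ^ 3 * ‖R m t‖ ≤ C * S ^ m := by
    calc S ^ 3 * ‖R m t‖ ≤ 1 * ‖R m t‖ := by
          gcongr
          exact pow_le_one₀ hS0 hS1
      _ ≤ C * ‖fun j => x j t‖ ^ m := by rw [one_mul]; exact hR t ht
      _ ≤ C * S ^ m := by gcongr
  calc _ ≤ S ^ 3 * (6 * ‖∑ j, ∑ k ∈ Finset.univ.erase j, pairKernel m (x j t) (x k t)‖ +
          ‖R m t‖) := by
        gcongr
        refine (norm_add_le _ _).trans ?_
        rw [norm_mul, norm_neg]
        simp
    _ ≤ _ := by linarith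

/-- Let the norm attain its maximum `S` on `[0, t]` at time `b`. Some power sum there is at least `c
* S ^ m`, but it grew from zero at rate at most `C m * S ^ (m - 3)`; hence `S ^ 3 ≤ K * t`. The
bound `M` on `m` makes `K` uniform. -/
theorem exists_norm_le_cubeRoot (h : IsPerturbedRationalFlow x δ R) :
    ∃ B : ℝ, 0 < B ∧ ∀ t ∈ Set.Ioo 0 δ, ‖fun j => x j t‖ ≤ B * cubeRoot t := by
  obtain ⟨c, hc, M, hcM⟩ := exists_le_norm_sum_pow N
  have hDm : ∀ m : ℕ, ∃ C : ℝ, 0 ≤ C ∧ (1 ≤ m → ∀ t ∈ Set.Ioo 0 δ, ∀ S ≤ 1,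
      ‖fun j => x j t‖ ≤ S →
      S ^ 3 * ‖-6 * ∑ j, ∑ k ∈ Finset.univ.erase j, pairKernel m (x j t) (x k t) + R m t‖ ≤
        C * S ^ m) := fun m => by
    by_cases hm : 1 ≤ m
    · obtain ⟨C, hC, hb⟩ := h.norm_deriv_le hm
      exact ⟨C, hC, fun _ => hb⟩
    · exact ⟨0, le_rfl, fun h => absurd h hm⟩
  choose C hC0 hC using hDm
  set K : ℝ := (∑ m ∈ Finset.Icc 1 M, C m) / c with hK
  have hK0 : 0 ≤ K := div_nonneg (Finset.sum_nonneg fun m _ => hC0 m) hc.le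
  have hcube : ∀ t ∈ Set.Ioo 0 δ, ‖fun j => x j t‖ ^ 3 ≤ K * t := by
    intro t ht
    have hcont : ContinuousOn (fun s => ‖fun j => x j s‖) (Set.Icc 0 t) :=
      (continuousOn_pi.2 fun j => (h.continuousOn j).mono fun s hs =>
        ⟨hs.1, hs.2.trans_lt ht.2⟩).norm
    obtain ⟨b, hb, hmax⟩ := isCompact_Icc.exists_isMaxOn ⟨0, le_rfl, ht.1.le⟩ hcont
    set S := ‖fun j => x j b‖ with hS
    have htS : ‖fun j => x j t‖ ≤ S := hmax ⟨ht.1.le, le_rfl⟩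
    have hmaxS : ∀ s ∈ Set.Icc 0 t, ‖fun j => x j s‖ ≤ S := fun s hs => hmax hs
    have hKt : 0 ≤ K * t := mul_nonneg hK0 ht.1.le
    suffices S ^ 3 ≤ K * t from (pow_le_pow_left₀ (norm_nonneg _) htS 3).trans this
    have hSn : 0 ≤ S := norm_nonneg _
    rcases hSn.eq_or_lt with hS0 | hS0
    · rw [← hS0]; simpa using hKt
    have hS1 : S ≤ 1 := h.norm_le_one b ⟨hb.1, hb.2.trans_lt ht.2⟩
    have hb0 : 0 < b := by
      refine hb.1.lt_of_ne fun e => hS0.ne' ?_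
      rw [hS, ← e]
      simp only [h.zero]
      exact norm_zero
    obtain ⟨m, hm, hcm⟩ := hcM ((S⁻¹ : ℂ) • fun j => x j b) (by
      rw [norm_smul, norm_inv, Complex.norm_real, Real.norm_of_nonneg hS0.le]
      exact inv_mul_cancel₀ hS0.ne')
    have hm1 := (Finset.mem_Icc.1 hm).1
    simp only [Pi.smul_apply, smul_eq_mul, mul_pow, ← Finset.mul_sum, norm_mul, norm_pow, norm_inv,
      Complex.norm_real, Real.norm_of_nonneg hS0.le] at hcm
    have h1 : c * S ^ m ≤ ‖∑ j, x j b ^ m‖ := by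
      rwa [inv_pow, inv_mul_eq_div, le_div_iff₀ (by positivity)] at hcm
    have h2 : ‖∑ j, x j b ^ m‖ ≤ C m * S ^ m / S ^ 3 * b := by
      refine norm_le_mul_of_norm_deriv_le (f := fun s => ∑ j, x j s ^ m) hb0 ?_ ?_
        (fun s hs => h.hasDerivAt m hm1 s ⟨hs.1, hs.2.trans_lt (hb.2.trans_lt ht.2)⟩)
        fun s hs => ?_
      · exact tendsto_finsetSum _ fun j _ => (h.continuousWithinAt_zero j).tendsto.pow m
      · simp [h.zero, show m ≠ 0 by lia]
      · rw [le_div_iff₀ (by positivity), mul_comm]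
        exact hC m hm1 s ⟨hs.1, hs.2.trans_lt (hb.2.trans_lt ht.2)⟩ S hS1
          (hmaxS s ⟨hs.1.le, hs.2.trans hb.2⟩)
    have h3 : C m ≤ ∑ m ∈ Finset.Icc 1 M, C m := Finset.single_le_sum (fun i _ => hC0 i) hm
    have h4 : c * S ^ m ≤ C m * S ^ m / S ^ 3 * b := h1.trans h2
    have h5 : c * S ^ 3 ≤ C m * b := by
      have e : C m * S ^ m / S ^ 3 * b = C m * b / S ^ 3 * S ^ m := by ring
      rw [e] at h4
      have := le_of_mul_le_mul_right h4 (by positivity)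
      rwa [le_div_iff₀ (by positivity)] at this
    rw [hK, div_mul_eq_mul_div, le_div_iff₀ hc, mul_comm]
    exact h5.trans (mul_le_mul h3 hb.2 hb0.le ((hC0 m).trans h3))
  -- A number that is at least `1` is at most its cube, so the cube of `max K 1` dominates `K`.
  refine ⟨max K 1, by positivity, fun t ht => ?_⟩
  have hτ := cubeRoot_pos ht.1
  rw [← pow_le_pow_iff_left₀ (norm_nonneg _) (by positivity) three_ne_zero, mul_pow,
    cubeRoot_pow_three ht.1.le]
  refine (hcube t ht).trans (mul_le_mul_of_nonneg_right ?_ ht.1.le)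
  exact (le_max_left K 1).trans (le_self_pow₀ (le_max_right K 1) three_ne_zero)

/-- Convergence of the rescaled power sums. -/
theorem tendsto_sum_pow (h : IsPerturbedRationalFlow x δ R) {m : ℕ} (hm : 1 ≤ m) {A : ℂ}
    (hA : Tendsto (fun t => ∑ j, ∑ k ∈ Finset.univ.erase j,
      pairKernel m (x j t / cubeRoot t) (x k t / cubeRoot t)) (𝓝[>] 0) (𝓝 A)) :
    Tendsto (fun t => ∑ j, (x j t / cubeRoot t) ^ m) (𝓝[>] 0) (𝓝 (-18 / m * A)) := by
  have hIoo : ∀ᶠ t in 𝓝[>] (0 : ℝ), t ∈ Set.Ioo 0 δ := Ioo_mem_nhdsGT h.pos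
  obtain ⟨B, hB, hxB⟩ := h.exists_norm_le_cubeRoot
  obtain ⟨C, hC, hR⟩ := h.remainder m hm
  have hrem : Tendsto (fun t => R m t * ((cubeRoot t : ℂ) ^ 3 / (cubeRoot t : ℂ) ^ m))
      (𝓝[>] 0) (𝓝 0) := by
    rw [tendsto_zero_iff_norm_tendsto_zero]
    refine squeeze_zero' (g := fun t => C * B ^ m * cubeRoot t ^ 3)
      (.of_forall fun _ => norm_nonneg _) ?_ ?_
    · filter_upwards [hIoo] with t ht
      have hτ := cubeRoot_pos ht.1
      rw [norm_mul, norm_div, norm_pow, norm_pow, Complex.norm_real, Real.norm_of_nonneg hτ.le]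
      calc ‖R m t‖ * (cubeRoot t ^ 3 / cubeRoot t ^ m)
          ≤ C * (B * cubeRoot t) ^ m * (cubeRoot t ^ 3 / cubeRoot t ^ m) := by
            gcongr
            exact (hR t ht).trans (by gcongr; exact hxB t ht)
        _ = C * B ^ m * cubeRoot t ^ 3 := by
            field_simp
            ring
    · simpa using (tendsto_cubeRoot.pow 3).const_mul (C * B ^ m)
  -- The constant `-18 / m` is the factor `-6` of the flow times `3 / m` from L'Hôpital's rule.
  have hlim := tendsto_div_cubeRoot_pow (f := fun t => ∑ j, x j t ^ m) (A := -6 * A + 0) hm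
    (hIoo.mono fun t ht => h.hasDerivAt m hm t ht) ?_ ?_
  · rw [show (-18 / m * A : ℂ) = 3 / m * (-6 * A + 0) by ring]
    refine hlim.congr fun t => ?_
    simp only [div_pow, Finset.sum_div]
  · have : Tendsto (fun t => ∑ j, x j t ^ m) (𝓝[>] 0) (𝓝 (∑ j, x j 0 ^ m)) :=
      tendsto_finsetSum _ fun j _ => ((h.continuousWithinAt_zero j).tendsto.mono_left
        (nhdsWithin_mono _ Set.Ioi_subset_Ici_self)).pow m
    simpa [h.zero, show m ≠ 0 by lia] using this
  · refine ((hA.const_mul (-6)).add hrem).congr' ?_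
    filter_upwards [hIoo] with t ht
    have hτ : (cubeRoot t : ℂ) ≠ 0 := by exact_mod_cast (cubeRoot_pos ht.1).ne'
    rw [add_mul, mul_assoc (-6 : ℂ), Finset.sum_mul]
    congr 2
    refine Finset.sum_congr rfl fun j _ => ?_
    rw [Finset.sum_mul]
    refine Finset.sum_congr rfl fun k _ => ?_
    have := pairKernel_mul_mul m (cubeRoot t) (x j t / cubeRoot t) (x k t / cubeRoot t)
    rw [mul_div_cancel₀ _ hτ, mul_div_cancel₀ _ hτ] at this
    field_simp
    linear_combination -this

/-- Strong induction: the limit is a polynomial in earlier limits. In each product the indices add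
up to `m - 3`, so for `3 ∤ m` one of them is not divisible by three. -/
theorem exists_tendsto_sum_pow (h : IsPerturbedRationalFlow x δ R) (m : ℕ) :
    ∃ q : ℂ, Tendsto (fun t => ∑ j, (x j t / cubeRoot t) ^ m) (𝓝[>] 0) (𝓝 q) ∧
      (¬ 3 ∣ m → q = 0) := by
  induction m using Nat.strong_induction_on with
  | _ m ih =>
    rcases Nat.eq_zero_or_pos m with rfl | hm
    · exact ⟨N, by simp, fun h3 => absurd (dvd_zero 3) h3⟩
    choose! q hq hq0 using ih
    have hA : Tendsto (fun t => ∑ j, ∑ k ∈ Finset.univ.erase j,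
        pairKernel m (x j t / cubeRoot t) (x k t / cubeRoot t)) (𝓝[>] 0)
        (𝓝 (∑ i ∈ Finset.range (m - 2), ((i + 1 : ℕ) : ℂ) * ((m - 2 - i : ℕ) : ℂ) *
          (q i * q (m - 3 - i)) - (m * (m - 1) * (m - 2) / 6) * q (m - 3))) := by
      simp only [sum_sum_pairKernel m]
      refine (tendsto_finsetSum _ fun i hi => ?_).sub ((hq _ (by lia)).const_mul _)
      have := Finset.mem_range.1 hi
      exact ((hq i (by lia)).mul (hq _ (by lia))).const_mul _
    refine ⟨_, h.tendsto_sum_pow hm hA, fun h3 => ?_⟩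
    rw [Finset.sum_eq_zero, zero_sub, mul_eq_zero, neg_eq_zero]
    · right
      -- For `m = 1, 2` the truncated index `m - 3` is `0`, whose power sum need not vanish; here
      -- the coefficient does.
      obtain rfl | rfl | hm3 : m = 1 ∨ m = 2 ∨ 3 ≤ m := by lia
      · simp
      · simp
      · rw [hq0 (m - 3) (by lia) (by lia), mul_zero]
    · intro i hi
      have := Finset.mem_range.1 hi
      by_cases h4 : 3 ∣ i
      · rw [hq0 (m - 3 - i) (by lia) (by lia), mul_zero, mul_zero]
      · rw [hq0 i (by lia) h4, zero_mul, mul_zero]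

end IsPerturbedRationalFlow

/-! ### From power sums to the individual points -/

/-- Bounded continuous functions with convergent power sums converge. -/
theorem exists_tendsto_of_tendsto_sum_pow {N : ℕ} {y : Fin N → ℝ → ℂ} {δ B : ℝ} {q : ℕ → ℂ}
    (hδ : 0 < δ) (hy : ∀ j, ContinuousOn (y j) (Set.Ioo 0 δ))
    (hB : ∀ t ∈ Set.Ioo 0 δ, ∀ j, ‖y j t‖ ≤ B)
    (hq : ∀ m, Tendsto (fun t => ∑ j, y j t ^ m) (𝓝[>] 0) (𝓝 (q m))) :
    ∃ a : Fin N → ℂ, ∀ j, Tendsto (y j) (𝓝[>] 0) (𝓝 (a j)) := by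
  have hU : ∀ U : Ultrafilter ℝ, (U : Filter ℝ) ≤ 𝓝[>] 0 → ∃ b : Fin N → ℂ,
      (∀ j, Tendsto (y j) U (𝓝 (b j))) ∧ ∀ m, ∑ j, b j ^ m = q m := by
    intro U hU
    have h1 : ∀ j, ∃ b, Tendsto (y j) U (𝓝 b) := fun j => by
      obtain ⟨b, -, hb⟩ := (isCompact_closedBall (0 : ℂ) B).ultrafilter_le_nhds (U.map (y j)) (by
        rw [le_principal_iff, Ultrafilter.mem_coe, Ultrafilter.mem_map]
        refine hU (mem_of_superset (Ioo_mem_nhdsGT hδ) fun t ht => ?_)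
        simpa using hB t ht j)
      exact ⟨b, hb⟩
    choose b hb using h1
    exact ⟨b, hb, fun m => tendsto_nhds_unique (tendsto_finsetSum _ fun j _ => (hb j).pow m)
      ((hq m).mono_left hU)⟩
  obtain ⟨a, ha, haq⟩ := hU (Ultrafilter.of (𝓝[>] 0)) (Ultrafilter.of_le _)
  refine ⟨a, fun j => Metric.tendsto_nhds.2 fun ε₀ hε₀ => ?_⟩
  obtain ⟨ε, hε, hεZ⟩ := (Set.Ioo_infinite hε₀).exists_notMem_finite
    (Set.finite_range fun k => dist (a k) (a j))
  -- All cluster points of `y j` lie in the finite range of `a`, and `ε` avoids their distances to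
  -- `a j`. The connected curve `y j` thus never crosses the circle of radius `ε` and, being inside
  -- it at some time, stays inside.
  have hV : ∀ᶠ t in 𝓝[>] 0, dist (y j t) (a j) ≠ ε := by
    refine Filter.mem_iff_ultrafilter.2 fun U hUl => ?_
    obtain ⟨b, hb, hbq⟩ := hU U hUl
    obtain ⟨k, hk⟩ : b j ∈ Set.range a :=
      range_subset_of_sum_pow_eq (fun m => (hbq m).trans (haq m).symm) ⟨j, rfl⟩
    refine ((hb j).dist tendsto_const_nhds).eventually_ne fun e => hεZ ⟨k, ?_⟩
    simpa [hk] using e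
  obtain ⟨η, hη, hηV⟩ := mem_nhdsGT_iff_exists_Ioo_subset.1
    (hV.and (Ioo_mem_nhdsGT hδ))
  have hη0 : (0 : ℝ) < η := hη
  have hsub : y j '' Set.Ioo 0 η ⊆ Metric.ball (a j) ε := by
    refine IsPreconnected.subset_left_of_subset_union Metric.isOpen_ball
      (Metric.isClosed_closedBall (x := a j) (ε := ε)).isOpen_compl ?_ ?_ ?_ ?_
    · exact disjoint_compl_right.mono_left Metric.ball_subset_closedBall
    · rintro _ ⟨t, ht, rfl⟩
      rcases lt_or_gt_of_ne (hηV ht).1 with h | h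
      · exact Or.inl h
      · exact Or.inr fun h' => absurd (Metric.mem_closedBall.1 h') (not_le.2 h)
    · have h1 : ∀ᶠ t in (Ultrafilter.of (𝓝[>] (0 : ℝ)) : Filter ℝ),
          t ∈ Set.Ioo 0 η ∧ dist (y j t) (a j) < ε :=
        Filter.Eventually.and (Ultrafilter.of_le _ (Ioo_mem_nhdsGT hη0))
          (Metric.tendsto_nhds.1 (ha j) ε hε.1)
      obtain ⟨t, ht, ht'⟩ := h1.exists
      exact ⟨y j t, ⟨t, ht, rfl⟩, ht'⟩
    · exact isPreconnected_Ioo.image _ ((hy j).mono fun t ht => (hηV ht).2)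
  filter_upwards [Ioo_mem_nhdsGT hη0] with t ht
  exact (Metric.mem_ball.1 (hsub ⟨t, ht, rfl⟩)).trans hε.2

/-! ### Distinctness and symmetry of the limits -/

open Polynomial in
/-- The rescaled locus equations, tested against polynomials. -/
theorem exists_kernel_of_sum_pow {N : ℕ} {a : Fin N → ℂ} {c : ℂ}
    (h : ∀ m : ℕ, 1 ≤ m → ∑ j, m * a j ^ m =
      c * ∑ j, ∑ k ∈ Finset.univ.erase j, pairKernel m (a j) (a k)) (f : ℂ[X]) :
    ∃ K : ℂ → ℂ → ℂ,
      (∀ z w, (z - w) ^ 3 * K z w = (f.derivative.eval z + f.derivative.eval w) * (z - w) -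
        2 * (f.eval z - f.eval w)) ∧
      (∀ z, 6 * K z z = (derivative^[3] f).eval z) ∧
      ∑ j, a j * f.derivative.eval (a j) =
        c * ∑ j, ∑ k ∈ Finset.univ.erase j, K (a j) (a k) := by
  -- All three properties are linear in `f`, so multiples of `pairKernel` for monomials suffice.
  induction f using Polynomial.induction_on' with
  | add f g hf hg =>
    obtain ⟨K, h1, h2, h3⟩ := hf
    obtain ⟨K', h1', h2', h3'⟩ := hg
    refine ⟨fun z w => K z w + K' z w, fun z w => ?_, fun z => ?_, ?_⟩
    · simp only [derivative_add, eval_add]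
      linear_combination h1 z w + h1' z w
    · rw [iterate_map_add, eval_add, ← h2, ← h2']
      ring
    · simp only [derivative_add, eval_add, mul_add, Finset.sum_add_distrib]
      rw [h3, h3']
  | monomial m b =>
    refine ⟨fun z w => b * pairKernel m z w, fun z w => ?_, fun z => ?_, ?_⟩
    · rw [mul_left_comm, cube_sub_mul_pairKernel]
      simp only [derivative_monomial, eval_monomial]
      ring
    · rw [mul_left_comm, six_mul_pairKernel_self]
      simp only [Function.iterate_succ, Function.iterate_zero, Function.comp, id,
        derivative_monomial, eval_monomial]
      rcases m with _ | _ | _ | m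
      · simp
      · simp
      · simp
      · simp
        ring
    · simp only [derivative_monomial, eval_monomial, ← Finset.mul_sum]
      rcases Nat.eq_zero_or_pos m with rfl | hm
      · simp [pairKernel]
      · rw [mul_left_comm, ← h m hm, Finset.mul_sum]
        refine Finset.sum_congr rfl fun j _ => ?_
        obtain ⟨n, rfl⟩ : ∃ n, m = n + 1 := ⟨m - 1, by lia⟩
        simp only [Nat.add_sub_cancel]
        ring

open Polynomial in
/-- The points of the rescaled rational locus are pairwise distinct. -/
theorem injective_of_sum_pow {N : ℕ} {a : Fin N → ℂ} {c : ℂ} (hc : c ≠ 0)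
    (h : ∀ m : ℕ, 1 ≤ m → ∑ j, m * a j ^ m =
      c * ∑ j, ∑ k ∈ Finset.univ.erase j, pairKernel m (a j) (a k)) :
    Function.Injective a := by
  classical
  intro i l hil
  by_contra hne
  set α := a i with hα
  set s : Finset ℂ := (Finset.univ.image a).erase α with hs
  set g : ℂ[X] := ∏ b ∈ s, (X - C b) ^ 4 with hg
  -- `f` and `f'` vanish at all points, `f'''` at all points but `α`. The relation thus says that
  -- the number of ordered pairs of distinct indices with value `α`, times `g(α) ≠ 0`, is zero.
  obtain ⟨K, h1, h2, h3⟩ := exists_kernel_of_sum_pow h ((X - C α) ^ 3 * g)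
  set f : ℂ[X] := (X - C α) ^ 3 * g with hf
  have hdvdα : (X - C α) ^ 3 ∣ f := dvd_mul_right _ _
  have hdvd : ∀ j, a j ≠ α → (X - C (a j)) ^ 4 ∣ f := fun j hj =>
    (Finset.dvd_prod_of_mem (fun b => (X - C b) ^ 4) (Finset.mem_erase.2
      ⟨hj, Finset.mem_image_of_mem a (Finset.mem_univ j)⟩)).mul_left _
  have hdvd3 : ∀ j, (X - C (a j)) ^ 3 ∣ f := fun j => by
    by_cases hj : a j = α
    · rw [hj]; exact hdvdα
    · exact (pow_dvd_pow _ (by norm_num)).trans (hdvd j hj)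
  have hder : ∀ (b : ℂ) (n k : ℕ) (p : ℂ[X]), k < n → (X - C b) ^ n ∣ p →
      (derivative^[k] p).eval b = 0 := fun b n k p hk hp => by
    refine eval_eq_zero_of_dvd_of_eval_eq_zero
      (p := X - C b) ((dvd_pow_self _ ?_).trans (pow_sub_dvd_iterate_derivative_of_pow_dvd k hp))
      (by simp)
    lia
  have hf0 : ∀ j, f.eval (a j) = 0 := fun j => hder (a j) 3 0 f (by norm_num) (hdvd3 j)
  have hf1 : ∀ j, f.derivative.eval (a j) = 0 := fun j =>
    hder (a j) 3 1 f (by norm_num) (hdvd3 j)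
  have hgα : g.eval α ≠ 0 := by
    rw [hg, eval_prod, Finset.prod_ne_zero_iff]
    intro b hb
    simp only [eval_pow, eval_sub, eval_X, eval_C]
    exact pow_ne_zero _ (sub_ne_zero.2 (Finset.ne_of_mem_erase hb).symm)
  have hKα : K α α = g.eval α := by
    have := h2 α
    have e : (derivative^[3] f).eval α = 6 * g.eval α := by
      simp only [hf, Function.iterate_succ, Function.iterate_zero, Function.comp, id,
        derivative_mul, derivative_add, derivative_X_sub_C_pow, eval_add, eval_mul, eval_sub,
        eval_pow, eval_X, eval_C]
      simp
      norm_num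
    rw [e] at this
    exact mul_left_cancel₀ (by norm_num) this
  have hK : ∀ j k, K (a j) (a k) = if a j = α ∧ a k = α then g.eval α else 0 := by
    intro j k
    split_ifs with hjk
    · rw [hjk.1, hjk.2, hKα]
    · by_cases e : a j = a k
      · have hj : a j ≠ α := fun hj => hjk ⟨hj, e ▸ hj⟩
        have := h2 (a j)
        rw [hder (a j) 4 3 f (by norm_num) (hdvd j hj)] at this
        rw [← e]
        simpa using this
      · have := h1 (a j) (a k)
        rw [hf0, hf0, hf1, hf1] at this
        have hz : (a j - a k) ^ 3 ≠ 0 := pow_ne_zero 3 (sub_ne_zero.2 e)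
        simpa [hz] using this
  have hsum : ∑ j, ∑ k ∈ Finset.univ.erase j, K (a j) (a k) =
      ((∑ j, ∑ k ∈ Finset.univ.erase j, if a j = α ∧ a k = α then 1 else 0 : ℕ) : ℂ) *
        g.eval α := by
    push_cast
    simp only [Finset.sum_mul, hK]
    refine Finset.sum_congr rfl fun j _ => Finset.sum_congr rfl fun k _ => ?_
    split_ifs <;> simp
  rw [hsum] at h3
  simp only [hf1, mul_zero, Finset.sum_const_zero] at h3
  have h4 := (mul_eq_zero.1 ((mul_eq_zero.1 h3.symm).resolve_left hc)).resolve_right hgα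
  rw [Nat.cast_eq_zero, Finset.sum_eq_zero_iff] at h4
  have h5 := Finset.sum_eq_zero_iff.1 (h4 i (Finset.mem_univ i)) l
    (Finset.mem_erase.2 ⟨Ne.symm hne, Finset.mem_univ l⟩)
  simp [← hil, ← hα] at h5

/-- The asymptotics of a perturbed rational flow. -/
theorem IsPerturbedRationalFlow.exists_tendsto {N : ℕ} {x : Fin N → ℝ → ℂ} {δ : ℝ} {R : ℕ → ℝ → ℂ}
    (h : IsPerturbedRationalFlow x δ R) :
    ∃ a : Fin N → ℂ, (∀ j, Tendsto (fun t => x j t / (cubeRoot t : ℂ)) (𝓝[>] 0) (𝓝 (a j))) ∧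
      Function.Injective a ∧
      ∀ η : ℂ, η ^ 3 = 1 → Set.range (fun j => η * a j) = Set.range a := by
  obtain ⟨B, hB, hxB⟩ := h.exists_norm_le_cubeRoot
  choose q hq hq0 using h.exists_tendsto_sum_pow
  have hcont : ∀ j, ContinuousOn (fun t => x j t / (cubeRoot t : ℂ)) (Set.Ioo 0 δ) := fun j => by
    refine ((h.continuousOn j).mono Set.Ioo_subset_Ico_self).div
      (Complex.continuous_ofReal.comp continuous_cubeRoot).continuousOn fun t ht => ?_
    exact_mod_cast (cubeRoot_pos ht.1).ne'
  have hbound : ∀ t ∈ Set.Ioo 0 δ, ∀ j, ‖x j t / (cubeRoot t : ℂ)‖ ≤ B := fun t ht j => by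
    have hτ := cubeRoot_pos ht.1
    rw [norm_div, Complex.norm_real, Real.norm_of_nonneg hτ.le, div_le_iff₀ hτ]
    exact (norm_le_pi_norm (fun j => x j t) j).trans (hxB t ht)
  obtain ⟨a, ha⟩ := exists_tendsto_of_tendsto_sum_pow h.pos hcont hbound hq
  have haq : ∀ m, ∑ j, a j ^ m = q m := fun m =>
    tendsto_nhds_unique (tendsto_finsetSum _ fun j _ => (ha j).pow m) (hq m)
  refine ⟨a, ha, injective_of_sum_pow (c := -18) (by norm_num) fun m hm => ?_, fun η hη => ?_⟩
  · have h1 : Tendsto (fun t => ∑ j, ∑ k ∈ Finset.univ.erase j,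
        pairKernel m (x j t / cubeRoot t) (x k t / cubeRoot t)) (𝓝[>] 0)
        (𝓝 (∑ j, ∑ k ∈ Finset.univ.erase j, pairKernel m (a j) (a k))) :=
      tendsto_finsetSum _ fun j _ => tendsto_finsetSum _ fun k _ =>
        Tendsto.comp (g := fun p : ℂ × ℂ => pairKernel m p.1 p.2)
          (f := fun t : ℝ => (x j t / (cubeRoot t : ℂ), x k t / (cubeRoot t : ℂ)))
          ((continuous_pairKernel m).tendsto (a j, a k)) ((ha j).prodMk_nhds (ha k))
    have h2 := tendsto_nhds_unique (h.tendsto_sum_pow hm h1) (hq m)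
    have hm0 : (m : ℂ) ≠ 0 := by exact_mod_cast (show m ≠ 0 by lia)
    rw [← Finset.mul_sum, haq, ← h2]
    field_simp
  -- Rotation by `η` multiplies the `m`-th power sum by `η ^ m`, which is `1` if `3 ∣ m`; the other
  -- power sums vanish.
  · refine range_eq_of_sum_pow_eq fun m => ?_
    simp only [mul_pow, ← Finset.mul_sum]
    by_cases h3 : 3 ∣ m
    · obtain ⟨k, rfl⟩ := h3
      rw [pow_mul, hη, one_pow, one_mul]
    · rw [haq, hq0 m h3, mul_zero]

/-! ### From the KdV solution to the perturbed flow -/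

theorem IsLameKdVSolution.exists_isPerturbedRationalFlow {L : PeriodPair} {n : ℕ} {ε : ℝ}
    (hε : 0 < ε) {u : ℂ → ℝ → ℂ} {x : Fin (n * (n + 1) / 2) → ℝ → ℂ}
    (h : IsLameKdVSolution L n ε u x) : ∃ δ R, IsPerturbedRationalFlow x δ R := by
  obtain ⟨r, hr, hrem⟩ := L.exists_norm_pairRemainder_le
  obtain ⟨ρ, hρ, hgap⟩ := Metric.mem_nhds_iff.1 (L.compl_lattice_sdiff_singleton_mem_nhds 0)
  have hgap' : ∀ d ∈ L.lattice, ‖d‖ < ρ → d = 0 := fun d hd hdρ => by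
    by_contra h0
    exact hgap (mem_ball_zero_iff.2 hdρ) ⟨hd, h0⟩
  -- The bound `1` is needed for `norm_le_one` and `r` for the remainder. With `ρ / 2`, pole
  -- differences are shorter than any nonzero lattice vector, so distinct poles are incongruent.
  set κ := min (min 1 r) (ρ / 2) with hκ
  have hκ0 : 0 < κ := by positivity
  have hsmall : ∀ᶠ t in 𝓝[≥] (0 : ℝ), ∀ j, ‖x j t‖ < κ := by
    rw [eventually_all]
    intro j
    have hc : ContinuousWithinAt (x j) (Set.Ici 0) 0 :=
      ((h.pole_continuousOn j) 0 ⟨le_rfl, hε⟩).mono_of_mem_nhdsWithin (Ico_mem_nhdsGE hε)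
    refine hc.norm.eventually_lt continuousWithinAt_const ?_
    simpa [h.pole_zero] using hκ0
  obtain ⟨δ, hδ0, hδ⟩ := mem_nhdsGE_iff_exists_Ico_subset.1 (hsmall.and (Ico_mem_nhdsGE hε))
  have hδ0' : (0 : ℝ) < δ := hδ0
  have hx : ∀ t ∈ Set.Ico 0 δ, ∀ j, ‖x j t‖ < κ := fun t ht => (hδ ht).1
  have hnorm : ∀ t ∈ Set.Ico 0 δ, ‖fun j => x j t‖ ≤ κ := fun t ht =>
    (pi_norm_le_iff_of_nonneg hκ0.le).2 fun j => (hx t ht j).le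
  have hdyn : ∀ t ∈ Set.Ioo 0 δ, ∀ i, HasDerivAt (x i)
      (-12 * ∑ k ∈ Finset.univ.erase i, L.weierstrassP (x i t - x k t)) t ∧
      ∑ k ∈ Finset.univ.erase i, L.derivWeierstrassP (x i t - x k t) = 0 := by
    intro t ht
    have htε : t ∈ Set.Ioo 0 ε := ⟨ht.1, (hδ ⟨ht.1.le, ht.2⟩).2.2⟩
    refine L.pole_dynamics (u := u) (fun j => (h.pole_continuousOn j).continuousAt
      (Ico_mem_nhds htε.1 htε.2)) (fun j k hjk hmem => h.pole_ne t htε j k hjk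
      (sub_eq_zero.1 (hgap' _ hmem ?_))) ?_ (h.kdv t htε)
    · have h1 := hx t ⟨ht.1.le, ht.2⟩ j
      have h2 := hx t ⟨ht.1.le, ht.2⟩ k
      have h3 : κ ≤ ρ / 2 := min_le_right _ _
      exact (norm_sub_le _ _).trans_lt (by linarith)
    · filter_upwards [Ico_mem_nhds htε.1 htε.2] with s hs using h.form s hs
  refine ⟨δ, fun m t => -6 * ∑ j, ∑ k ∈ Finset.univ.erase j,
    L.pairRemainder m (x j t) (x k t), hδ0', h.pole_zero, fun j => (h.pole_continuousOn j).mono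
    fun t ht => (hδ ht).2, fun t ht => (hnorm t ht).trans ((min_le_left _ _).trans (min_le_left _ _)),
    fun m _ t ht => L.hasDerivAt_sum_pow
      (h.pole_ne t ⟨ht.1, (hδ ⟨ht.1.le, ht.2⟩).2.2⟩) (fun i => (hdyn t ht i).1)
      (fun i => (hdyn t ht i).2) m, fun m hm => ?_⟩
  obtain ⟨C, hC, hb⟩ := hrem m hm
  refine ⟨6 * ∑ j : Fin (n * (n + 1) / 2), ∑ k ∈ Finset.univ.erase j, C, ?_, fun t ht => ?_⟩
  · exact mul_nonneg (by norm_num) (Finset.sum_nonneg fun _ _ => Finset.sum_nonneg fun _ _ => hC)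
  · have hS : ‖fun j => x j t‖ ≤ r :=
      (hnorm t ⟨ht.1.le, ht.2⟩).trans ((min_le_left _ _).trans (min_le_right _ _))
    rw [norm_mul, norm_neg, mul_assoc]
    simp only [Complex.norm_ofNat]
    refine mul_le_mul_of_nonneg_left ((norm_sum_le _ _).trans ?_) (by norm_num)
    rw [Finset.sum_mul]
    refine Finset.sum_le_sum fun j _ => (norm_sum_le _ _).trans ?_
    rw [Finset.sum_mul]
    exact Finset.sum_le_sum fun k _ => hb _ _ _ hS (norm_le_pi_norm (fun j => x j t) j)
      (norm_le_pi_norm (fun j => x j t) k)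

/-! ### Orbits of the cube roots of unity -/

/-- A finite set of nonzero complex numbers which is invariant under the cube roots of unity has
cardinality divisible by three. -/
theorem three_dvd_card_of_image_eq {η : ℂ} (hη : IsPrimitiveRoot η 3) {A : Finset ℂ} (h0 : 0 ∉ A)
    (hA : A.image (fun z => η * z) = A) : 3 ∣ A.card := by
  -- Multiplication by `η` permutes `A`, so the nonzero product of its elements is unchanged and `η
  -- ^ A.card = 1`.
  have h1 : ∏ z ∈ A, z = η ^ A.card * ∏ z ∈ A, z := by
    conv_lhs => rw [← hA]
    rw [Finset.prod_image fun z _ w _ e => mul_left_cancel₀ (hη.ne_zero three_ne_zero) e,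
      Finset.prod_mul_distrib, Finset.prod_const]
  have h2 : ∏ z ∈ A, z ≠ 0 := Finset.prod_ne_zero_iff.2 fun z hz e => h0 (e ▸ hz)
  exact hη.dvd_of_pow_eq_one _ (mul_right_cancel₀ h2 (by rw [one_mul]; exact h1.symm))

theorem three_dvd_card_of_range_eq {N : ℕ} {a : Fin N → ℂ} (ha : Function.Injective a)
    (h : ∀ η : ℂ, η ^ 3 = 1 → Set.range (fun j => η * a j) = Set.range a) :
    ((∀ j, a j ≠ 0) → 3 ∣ N) ∧ ((∃ j, a j = 0) → 3 ∣ N - 1) := by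
  have hη := Complex.isPrimitiveRoot_exp 3 three_ne_zero
  set η := Complex.exp (2 * Real.pi * Complex.I / (3 : ℕ))
  set A : Finset ℂ := Finset.univ.image a with hA
  have hcard : A.card = N := by rw [hA, Finset.card_image_of_injective _ ha, Finset.card_fin]
  have hinv : A.image (fun z => η * z) = A := by
    apply Finset.coe_injective
    rw [hA, Finset.image_image]
    simp only [Finset.coe_image, Finset.coe_univ, Set.image_univ]
    exact h η hη.pow_eq_one
  constructor
  · intro h0
    have := three_dvd_card_of_image_eq hη (A := A) (by simpa [hA] using h0) hinv
    rwa [hcard] at this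
  · rintro ⟨j, hj⟩
    have hmem : (0 : ℂ) ∈ A := Finset.mem_image.2 ⟨j, Finset.mem_univ j, hj⟩
    have h1 : (A.erase 0).image (fun z => η * z) = A.erase 0 := by
      rw [Finset.image_erase (mul_right_injective₀ (hη.ne_zero three_ne_zero)), hinv, mul_zero]
    have := three_dvd_card_of_image_eq hη (A := A.erase 0) (by simp) h1
    rwa [Finset.card_erase_of_mem hmem, hcard] at this

theorem stabilizer_rootsOfUnity_eq_bot {z : ℂ} (hz : z ≠ 0) :
    MulAction.stabilizer (rootsOfUnity 3 ℂ) z = ⊥ := by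
  rw [Subgroup.eq_bot_iff_forall]
  intro η hη
  have h1 : ((η : ℂˣ) : ℂ) * z = z := MulAction.mem_stabilizer_iff.1 hη
  exact Subtype.ext (Units.ext (mul_right_cancel₀ hz (by simpa using h1)))

theorem orbit_rootsOfUnity_eq_of_cube_eq {z w : ℂ} (h : z ^ 3 = w ^ 3) :
    MulAction.orbit (rootsOfUnity 3 ℂ) z = MulAction.orbit (rootsOfUnity 3 ℂ) w := by
  rcases eq_or_ne w 0 with rfl | hw
  · rw [pow_eq_zero_iff three_ne_zero |>.1 (h.trans (zero_pow three_ne_zero))]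
  · rw [MulAction.orbit_eq_iff]
    have h1 : (z / w) ^ 3 = 1 := by rw [div_pow, h, div_self (pow_ne_zero 3 hw)]
    refine ⟨rootsOfUnity.mkOfPowEq (z / w) h1, ?_⟩
    change ((rootsOfUnity.mkOfPowEq (z / w) h1 : ℂˣ) : ℂ) * w = z
    rw [rootsOfUnity.coe_mkOfPowEq, div_mul_cancel₀ _ hw]

theorem mainTheorem12 (L : PeriodPair) (n : ℕ) (hn : 1 ≤ n) (ε : ℝ) (hε : 0 < ε)
    (u : ℂ → ℝ → ℂ) (x : Fin (n * (n + 1) / 2) → ℝ → ℂ) (h : IsLameKdVSolution L n ε u x) :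
    ∃ a : Fin (n * (n + 1) / 2) → ℂ,
      -- `x j t = a j t^(1/3) + o(t^(1/3))` as `t → +0`
      (∀ j, Tendsto (fun t : ℝ => x j t / ((t ^ (1 / 3 : ℝ) : ℝ) : ℂ)) (𝓝[>] 0) (𝓝 (a j))) ∧
      Function.Injective a ∧
      -- the set of the `a j` is invariant under the cube roots of unity
      (∀ η : rootsOfUnity 3 ℂ, η • Set.range a = Set.range a) ∧
      -- every orbit that occurs is contained in the family exactly once
      (∀ j, Set.BijOn a {k | a k ∈ MulAction.orbit (rootsOfUnity 3 ℂ) (a j)}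
        (MulAction.orbit (rootsOfUnity 3 ℂ) (a j))) ∧
      (3 ∣ n * (n + 1) / 2 → ∀ j, MulAction.stabilizer (rootsOfUnity 3 ℂ) (a j) = ⊥) ∧
      (¬ 3 ∣ n * (n + 1) / 2 → ∃! j, a j = 0) ∧
      (∀ j, a j ≠ 0 → MulAction.stabilizer (rootsOfUnity 3 ℂ) (a j) = ⊥) ∧
      (∀ j k, MulAction.orbit (rootsOfUnity 3 ℂ) (a j) ≠ MulAction.orbit (rootsOfUnity 3 ℂ) (a k) →
        a j ^ 3 ≠ a k ^ 3) := by
  obtain ⟨δ, R, hflow⟩ := h.exists_isPerturbedRationalFlow hε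
  obtain ⟨a, ha, hinj, hrange⟩ := hflow.exists_tendsto
  obtain ⟨hcard, hcard'⟩ := three_dvd_card_of_range_eq hinj hrange
  have hsmul : ∀ η : rootsOfUnity 3 ℂ, η • Set.range a = Set.range a := fun η => by
    have hη : ((η : ℂˣ) : ℂ) ^ 3 = 1 := by
      rw [← Units.val_pow_eq_pow_val, (mem_rootsOfUnity 3 (η : ℂˣ)).1 η.2, Units.val_one]
    exact (Set.range_comp (fun z => η • z) a).symm.trans (hrange _ hη)
  refine ⟨a, ha, hinj, hsmul, fun j => ⟨fun k hk => hk, hinj.injOn, ?_⟩, fun h3 j => ?_,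
    fun h3 => ?_, fun j hj => stabilizer_rootsOfUnity_eq_bot hj,
    fun j k hjk e => hjk (orbit_rootsOfUnity_eq_of_cube_eq e)⟩
  · rintro _ ⟨η, rfl⟩
    have hmem : η • a j ∈ Set.range a := by
      rw [← hsmul η]
      exact Set.smul_mem_smul_set ⟨j, rfl⟩
    obtain ⟨k, hk⟩ := hmem
    exact ⟨k, ⟨η, hk.symm⟩, hk⟩
  · refine stabilizer_rootsOfUnity_eq_bot fun h0 => ?_
    have h1 := hcard' ⟨j, h0⟩
    -- The index `j` shows that the number of poles is positive, so the subtraction in `h1` is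
    -- genuine and contradicts `h3`.
    have h2 := j.pos
    lia
  · obtain ⟨j, hj⟩ : ∃ j, a j = 0 := by
      by_contra! h0
      exact h3 (hcard h0)
    exact ⟨j, hj, fun k hk => hinj (hk.trans hj.symm)⟩
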